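/- **Setting.** Let $\mathcal O=\mathbb C[[x,y]]$ be the formal local ring of a smooth complex surface germ, with local coordinates $(x,y)$ chosen so that the given smooth reference branch is $L=Z(x)$. A *branch* is an irreducible element of $\mathcal O$ up to units, $Z(f)$ being the branch of an irreducible $f$; $(L\cdot Z(f))=\dim_{\mathbb C}\mathcal O/(x,f)$. A *Newton–Puiseux series* is a series $\eta=\psi(x^{1/n})$ with $n\ge 1$, $\psi\in\mathbb C[[t]]$; $\nu_x(\eta)\in[0,\infty]$ is its order in $x$. For a branch $A$, $\mathrm{Zer}(A)$ is the set of Newton–Puiseux series $\eta$ with $\nu_x(\eta)>0$ that are roots $f(x,\eta)=0$ of an equation $f$ of $A$ (so $\mathrm{Zer}(L)=\emptyset$). For $\nu_x(\xi)>0$, $C_\xi$ is the branch defined by the minimal polynomial of $\xi$ over $\mathbb C[[x]]$. *Eggers–Wall tree.* For a branch $A\ne L$, its characteristic exponents $\alpha_1<\dots<\alpha_g$ are the orders $\nu_x(\eta-\eta')$ of differences of distinct elements of $\mathrm{Zer}(A)$; put $\alpha_0=0$, $\alpha_{g+1}=\infty$. The segment $\Theta_L(A)$ is a copy of $[0,\infty]$,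 the coordinate being called the exponent; its ends of exponents $0$ and $\infty$ are labelled $L$ and $A$. The index at exponent $a$ is the index of $\mathbb Z$ in the subgroup of $\mathbb Q$ generated by $1$ and the $\alpha_j<a$; let $\mathbf i_j$ be its value on $(\alpha_j,\alpha_{j+1}]$. The contact complexity of the point of exponent $a\in[\alpha_l,\alpha_{l+1}]$ is $$\mathbf c_L=\sum_{j=1}^{l}\frac{\alpha_j-\alpha_{j-1}}{\mathbf i_{j-1}}+\frac{a-\alpha_l}{\mathbf i_l}.$$ For branches $A\neq B$ different from $L$, let $k_L(A,B)=\max\{\nu_x(\eta-\eta')\mid \eta\in\mathrm{Zer}(A),\ \eta'\in\mathrm{Zer}(B)\}$. For a reduced germ $C$ (a finite set of branches), $\Theta_L(C)$ is obtained from the segments $\Theta_L(A)$, $A\ne L$ a branch of $C$, by identifying points of equal exponent $\le k_L(A,B)$ on $\Theta_L(A)$ and $\Theta_L(B)$; if $L$ is a branch of $C$, its segment is one point, identified with the root (the common point of exponent $0$). The contact complexities glue to $\mathbf c_L:\Theta_L(C)\to[0,\infty]$. The tree has the partial order $P\preceq_L Q\iff[L,P]\subseteq[L,Q]$, and $\langle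 P,Q,R\rangle$ denotes the unique common point of the segments $[P,Q],[Q,R],[P,R]$. If $C\subseteq D$ then $\Theta_L(C)\subseteq\Theta_L(D)$. *The functions.* For a Newton–Puiseux series $\xi$ with $\nu_x(\xi)>0$, $\alpha\in(0,\infty]$ and $f\in\mathcal O$, let $$\nu^{\xi,\alpha}(f)=\inf\{\nu_x(f(x,\eta))\mid \eta\text{ a Newton–Puiseux series},\ \nu_x(\eta-\xi)\ge\alpha\}\in[0,\infty],$$ and let $\nu^{\xi,0}=\mathrm{ord}^L$ be the order of vanishing along $L$. For a reduced germ $C$ and $P\in\Theta_L(C)$, put $V_L^P=\nu^{\xi,\alpha}$ if $C_\xi$ is a branch of $C$ and $P$ is the point of exponent $\alpha$ of $[L,C_\xi]$, and $V_L^L=\mathrm{ord}^L$ at the root. For a branch $A=Z(f)$, write $V_L^P(A)=V_L^P(f)$. **Proposition.** (1) Let $f\in\mathcal O$ be irreducible, $\xi$ a Newton–Puiseux series with $\nu_x(\xi)>0$, and $\alpha\in[0,\infty]$. There is a unique point $P(\alpha)\in\Theta_L(C_\xi)$ of exponent $\alpha$, and $$\nu^{\xi,\alpha}(f)=\begin{cases}(L\cdot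 Z(f))\cdot\mathbf c_L\big(\min\{P(\alpha),\langle L,C_\xi,Z(f)\rangle\}\big)&\text{if }Z(f)\ne L,\\ 1&\text{if }Z(f)=L,\end{cases}$$ where the center and the minimum (which exists, for $\preceq_L$) are taken in the Eggers–Wall tree of the germ with branches $C_\xi$ and $Z(f)$. (2) Let $C$ be a reduced germ. The map $P\mapsto V_L^P$ is well defined on $\Theta_L(C)$: every point receives exactly one function $\mathcal O\to[0,\infty]$, independent of the choice of $\xi$ and of the branch $C_\xi$. For every $P\in\Theta_L(C)$ and every branch $A$, $$V_L^P(A)=\begin{cases}(L\cdot A)\cdot\mathbf c_L\big(\min\{P,\langle L,P,A\rangle\}\big)&\text{if }A\ne L,\\ 1&\text{if }A=L,\end{cases}$$ where the center and the minimum are taken in the Eggers–Wall tree of the germ whose branches are $A$ and those of $C$. -/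

import Mathlib

open scoped ENNReal

noncomputable section

namespace EggersWall

/-! ### Series, substitution, intersection numbers -/

/-- The formal local ring `ℂ⟦x, y⟧` of a smooth surface germ, in local coordinates `(x, y)`. -/
abbrev FormalRing : Type := MvPowerSeries (Fin 2) ℂ

/-- The coordinate `x`, whose divisor is the reference branch `L`. -/
def xCoord : FormalRing := MvPowerSeries.X 0

/-- Effective divisors: nonzero elements up to units. The branches are the irreducible ones. -/
abbrev Divisor : Type := Associates FormalRing

/-- The divisor `Z(f)` of `f`. -/
def Z (f : FormalRing) : Divisor := Associates.mk f

/-- The smooth reference branch `L = Z(x)`. -/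
def L : Divisor := Z xCoord

/-- The intersection number `(Z(f) · Z(g)) = dim_ℂ ℂ⟦x, y⟧ / (f, g)`. -/
def intersectionNumber (f g : FormalRing) : ℕ∞ :=
  Cardinal.toENat (Module.rank ℂ (FormalRing ⧸ Ideal.span {f, g}))

/-- Series in `x` with rational exponents and well-ordered support; the Newton-Puiseux series
are among them. -/
abbrev GenSeries : Type := HahnSeries ℚ ℂ

/-- `η` is a Newton-Puiseux series, i.e. `η = ψ(x^{1/n})` for some `n ≥ 1` and `ψ ∈ ℂ⟦t⟧`. -/
def IsNewtonPuiseux (η : GenSeries) : Prop :=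
  ∃ n : ℕ, n ≠ 0 ∧ ∀ q ∈ η.support, ∃ k : ℕ, q = (k : ℚ) / n

/-- A nonnegative rational number as an element of `[0, ∞]`. -/
def ratVal (q : ℚ) : ℝ≥0∞ := ENNReal.ofReal (q : ℝ)

open Classical in
/-- The order `ν_x(η) ∈ [0, ∞]` of a series with nonnegative exponents. -/
def nuX (η : GenSeries) : ℝ≥0∞ := if η = 0 then ⊤ else ratVal η.order

/-- The series `f(x, η) = ∑ f_{ij} x^i η^j`, for `η` of positive order. -/
def evalAt (f : FormalRing) (η : GenSeries) : GenSeries :=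
  (HahnSeries.SummableFamily.smulFamily
    (fun p : ℕ × ℕ =>
      MvPowerSeries.coeff (Finsupp.single 0 p.1 + Finsupp.single 1 p.2) f)
    ((HahnSeries.SummableFamily.powers (HahnSeries.single (1 : ℚ) (1 : ℂ))).mul
      (HahnSeries.SummableFamily.powers η))).hsum

/-! ### The functions `ν^{ξ, α}` -/

/-- `NP_x(ξ, α)`: the Newton-Puiseux series `η` with `ν_x(η - ξ) ≥ α`. -/
def npBall (ξ : GenSeries) (α : ℝ≥0∞) : Set GenSeries :=
  {η | IsNewtonPuiseux η ∧ α ≤ nuX (η - ξ)}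

/-- The vanishing order along `L`: the multiplicity of `L` in the divisor of `f`. -/
def ordL (f : FormalRing) : ℝ≥0∞ := ((emultiplicity xCoord f : ℕ∞) : ℝ≥0∞)

open Classical in
/-- `ν^{ξ, α}(f)` is the infimum of `ν_x(f(x, η))` over `η ∈ NP_x(ξ, α)` if `α > 0`, and
`ν^{ξ, 0} = ord^L`. -/
def nu (ξ : GenSeries) (α : ℝ≥0∞) (f : FormalRing) : ℝ≥0∞ :=
  if α = 0 then ordL f else ⨅ η ∈ npBall ξ α, nuX (evalAt f η)

/-! ### Branches and their numerical data -/

/-- A polynomial in `y` over `ℂ⟦x⟧`, seen in `ℂ⟦x, y⟧`. -/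
def polyToSeries (p : Polynomial (PowerSeries ℂ)) : FormalRing :=
  fun d => PowerSeries.coeff (d 0) (p.coeff (d 1))

/-- The branch `C_ξ`, defined by the minimal polynomial of `ξ` over `ℂ⟦x⟧`. -/
def branchOf (ξ : GenSeries) : Divisor := Z (polyToSeries (minpoly (PowerSeries ℂ) ξ))

/-- The set `Zer` of Newton-Puiseux roots of `A`. -/
def roots (A : Divisor) : Set GenSeries :=
  {η | IsNewtonPuiseux η ∧ 0 < η.orderTop ∧ ∀ f : FormalRing, Z f = A → evalAt f η = 0}

/-- The characteristic exponents of `A` relative to `L`. -/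
def charExps (A : Divisor) : Set ℚ :=
  {q | ∃ η ∈ roots A, ∃ η' ∈ roots A, η ≠ η' ∧ q = (η - η').order}

/-- The index function of `A` at the point of exponent `a`: the index of `ℤ` in the group
generated by `1` and the characteristic exponents that are less than `a`. -/
def index (A : Divisor) (a : ℝ≥0∞) : ℕ :=
  (AddSubgroup.zmultiples (1 : ℚ)).relIndex
    (AddSubgroup.closure ({1} ∪ {q | q ∈ charExps A ∧ ratVal q < a}))

/-- The sequence `α₀ = 0 < α₁ < ⋯ < α_g < α_{g+1} = ∞`, where `α₁ < ⋯ < α_g` are the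
characteristic exponents of `A` (continued by the value `∞`; recall `sInf ∅ = ∞`). -/
def alpha (A : Divisor) : ℕ → ℝ≥0∞
  | 0 => 0
  | j + 1 => sInf {b | alpha A j < b ∧ ∃ q ∈ charExps A, b = ratVal q}

/-- The contact complexity of the point of exponent `a` on the segment of `A`:
`∑_{j=1}^{l} (α_j - α_{j-1}) / i_{j-1} + (a - α_l) / i_l` where `a ∈ [α_l, α_{l+1}]` and `i_j` is
the index on `(α_j, α_{j+1}]`. -/
def contactOnBranch (A : Divisor) (a : ℝ≥0∞) : ℝ≥0∞ :=
  let l := sInf {l : ℕ | a ≤ alpha A (l + 1)}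
  (∑ j ∈ Finset.range l, (alpha A (j + 1) - alpha A j) / (index A (alpha A (j + 1)) : ℝ≥0∞))
    + (a - alpha A l) / (index A (alpha A (l + 1)) : ℝ≥0∞)

/-- The order of coincidence `k_L(A, B)` of two distinct branches other than `L`: the largest
`ν_x(η_A - η_B)` for roots `η_A`, `η_B`. It is `0` if `A` or `B` is `L`, which has no roots. -/
def coincidence (A B : Divisor) : ℝ≥0∞ :=
  sSup {k | ∃ η ∈ roots A, ∃ η' ∈ roots B, k = nuX (η - η')}

/-! ### The Eggers-Wall tree -/

/-- The disjoint union of the segments of the branches in `C`, each identified with `[0, ∞]` by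
its exponent function; the segment of `L` is the single point `0`. -/
structure PrePoint (C : Set Divisor) where
  branch : C
  exponent : ℝ≥0∞
  exponent_eq_zero : branch.1 = L → exponent = 0

/-- The gluing of the segments of `A` and `B` along their initial parts `[0, k_L(A, B)]`
(for `L` and another branch: at the root). -/
def glue {C : Set Divisor} (p q : PrePoint C) : Prop :=
  p.exponent = q.exponent ∧
    (p.branch = q.branch ∨ p.exponent ≤ coincidence p.branch.1 q.branch.1)

/-- The Eggers-Wall tree `Θ_L(C)` of the reduced germ with set of branches `C`. -/
def EWTree (C : Set Divisor) : Type := Quot (glue (C := C))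

namespace EWTree

variable {C D : Set Divisor}

/-- The exponent function `e_L`. -/
def exponent : EWTree C → ℝ≥0∞ := Quot.lift PrePoint.exponent fun _ _ h => h.1

open Classical in
/-- The point of exponent `a` on the segment of `A` (the root if `A = L`). -/
def point (A : C) (a : ℝ≥0∞) : EWTree C :=
  Quot.mk _ ⟨A, if A.1 = L then 0 else a, fun h => if_pos h⟩

/-- The root, as the initial point of the segment of any branch `A`. -/
def root (A : C) : EWTree C := point A 0

/-- The end labelled by `A` (which is the root if `A = L`). -/
def leaf (A : C) : EWTree C := point A ⊤

/-- The segment `[L, P]` from the root to `P`. -/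
def rootSegment (P : EWTree C) : Set (EWTree C) :=
  {Q | ∃ (A : C) (a b : ℝ≥0∞), P = point A a ∧ Q = point A b ∧ b ≤ a}

theorem exists_eq_point (P : EWTree C) : ∃ (A : C) (a : ℝ≥0∞), P = point A a := by
  induction P using Quot.ind with
  | mk p =>
    obtain ⟨A, a, h⟩ := p
    refine ⟨A, a, ?_⟩
    unfold point
    congr 2
    split_ifs with hA
    · exact h hA
    · rfl

theorem mem_rootSegment_self (P : EWTree C) : P ∈ rootSegment P := by
  obtain ⟨A, a, h⟩ := exists_eq_point P
  exact ⟨A, a, a, h, h, le_rfl⟩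

open Classical in
theorem exponent_point (A : C) (a : ℝ≥0∞) :
    exponent (point A a) = if A.1 = L then 0 else a := rfl

theorem exponent_le_of_mem {P Q : EWTree C} (h : Q ∈ rootSegment P) :
    exponent Q ≤ exponent P := by
  obtain ⟨A, a, b, rfl, rfl, hab⟩ := h
  rw [exponent_point, exponent_point]
  split_ifs
  · exact le_rfl
  · exact hab

theorem eq_of_mem {P Q : EWTree C} (h : Q ∈ rootSegment P) (he : exponent P ≤ exponent Q) :
    P = Q := by
  obtain ⟨A, a, b, rfl, rfl, hab⟩ := h
  rw [exponent_point, exponent_point] at he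
  unfold point
  congr 2
  split_ifs at he ⊢ with hA
  · rfl
  · exact le_antisymm he hab

/-- The partial order `⪯_L` defined by the root: `P ⪯_L Q` iff `[L, P] ⊆ [L, Q]`. -/
instance : PartialOrder (EWTree C) where
  le P Q := rootSegment P ⊆ rootSegment Q
  le_refl _ := subset_rfl
  le_trans _ _ _ := subset_trans
  le_antisymm P Q h h' :=
    (eq_of_mem (h (mem_rootSegment_self P))
      (exponent_le_of_mem (h' (mem_rootSegment_self Q)))).symm

/-- The inclusion `Θ_L(C) ⊆ Θ_L(D)` for `C ⊆ D`. -/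
def incl (h : C ⊆ D) : EWTree C → EWTree D :=
  Quot.map (fun p => ⟨⟨p.branch.1, h p.branch.2⟩, p.exponent, p.exponent_eq_zero⟩)
    fun _ _ hpq => ⟨hpq.1, by
      rcases hpq.2 with e | e
      · exact Or.inl (Subtype.ext (congrArg (fun B : C => B.1) e))
      · exact Or.inr e⟩

/-- The contact complexity `c_L`, obtained by gluing the contact complexities of the branches:
its value at `P` is computed on any branch whose segment contains `P` (glued branches have the
same characteristic exponents below the gluing exponent, so the choice does not matter). -/
def contact (P : EWTree C) : ℝ≥0∞ :=
  contactOnBranch (Quot.out P).branch.1 (Quot.out P).exponent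

/-- The compact segment `[P, Q]`: the points `X` with `P ∧ Q ⪯ X ⪯ P` or `P ∧ Q ⪯ X ⪯ Q`. -/
def segment (P Q : EWTree C) : Set (EWTree C) :=
  {X | ∃ M, IsGLB {P, Q} M ∧ M ≤ X ∧ (X ≤ P ∨ X ≤ Q)}

/-- `X` is the center `⟨P, Q, R⟩` of the tripod generated by `P`, `Q`, `R`: the only common point
of the segments that join them pairwise. -/
def IsTripodCenter (P Q R X : EWTree C) : Prop :=
  segment P Q ∩ segment Q R ∩ segment P R = {X}

end EWTree

/-- `V` is the map `V_L` on `Θ_L(C)`: `V_L^P = ν^{ξ, α}` whenever `C_ξ` is a branch of `C` and `P`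
is the point of exponent `α` in `[L, C_ξ]`; and `V_L` is `ord^L` at the root (which is implied
unless `L` is the only branch of `C`). -/
def IsEmbeddingMap (C : Set Divisor) (V : EWTree C → FormalRing → ℝ≥0∞) : Prop :=
  (∀ P : EWTree C, P.exponent = 0 → V P = ordL) ∧
  ∀ ξ : GenSeries, IsNewtonPuiseux ξ → 0 < ξ.orderTop → ∀ h : branchOf ξ ∈ C,
    ∀ (α : ℝ≥0∞) (P : EWTree C), P ≤ EWTree.leaf ⟨branchOf ξ, h⟩ → P.exponent = α →
      V P = nu ξ α

end EggersWall

end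

open EggersWall

/-!
Everything rests on the action of the monodromy `x ^ q ↦ exp (2 π i q) x ^ q` on the series with
rational exponents (`turn`). By Weierstrass preparation and the Newton-Puiseux theorem
(`Distinguished.exists_root`) each branch other than `L` is some `C_η`. If the exponents of `η` lie
in `(1 / N) ℕ`, the product of `y - s` over the finite orbit of `η` descends to `ℂ⟦x⟧`, so it is the
minimal polynomial of `η` (`IsPosNP.minPoly_spec`), and Weierstrass division shows that the series
vanishing at `η` are the multiples of it. Hence `Zer (C_η)` is the orbit of `η`, `(L · C_η)` is its
cardinality, and `ν_x(f(x, ζ)) = ∑ ν_x(ζ - s)`, the sum over the orbit, for any equation `f` of `C_η`.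

Infima over balls: a generic perturbation of `ξ` of exponent slightly above `α` has no excess contact
with the roots of `f`, so `ν^{ξ, α}(f) = ∑ min α (ν_x(ξ - s))` (`nu_eq_sum`). If `η` is a root of `f`
with the largest contact `k` with `ξ`, the ultrametric inequality turns this into
`∑ min (min α k) (ν_x(η - s))`.

Mean contacts: `ν_x(η - s) ≥ a` for the conjugate `s` under the `m`-th power of the monodromy exactly
when `m q ∈ ℤ` for all characteristic exponents `q < a`, and these `m` have density `1 / index`
(`card_selfContact_mul_index`). Summing over the intervals between characteristic exponents shows
that the contact complexity at exponent `a` is the mean over the orbit of `min a (ν_x(η - s))`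
(`sum_conj_min`). This gives the formula `nu_eq_mul_contact`, and also that contact complexities of
glued branches agree (`contactOnBranch_congr`).

In the tree, gluing is an equivalence relation by the ultrametric inequality, the meet of two points
is found at the least of their exponents and the order of coincidence of their branches
(`isGLB_point`), and the center of a tripod with one end at the root is the meet of the other two
(`isTripodCenter_root`). Finally `ν^{ξ, α}` is invariant under the monodromy and depends only on the
ball around `ξ`, hence only on the point of the tree (`nu_congr`).
-/

noncomputable section

namespace EggersWall

/-! ### Distinguished polynomials and the Newton-Puiseux theorem -/

open PowerSeries in
instance isAdicComplete_powerSeries :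
    IsAdicComplete (IsLocalRing.maximalIdeal (PowerSeries ℂ)) (PowerSeries ℂ) := by
  rw [PowerSeries.maximalIdeal_eq_span_X]; infer_instance

theorem mem_maximalIdeal_iff_constantCoeff (a : PowerSeries ℂ) :
    a ∈ IsLocalRing.maximalIdeal (PowerSeries ℂ) ↔ PowerSeries.constantCoeff a = 0 := by
  rw [PowerSeries.maximalIdeal_eq_span_X, Ideal.mem_span_singleton, PowerSeries.X_dvd_iff]

theorem residue_eq_zero_iff_constantCoeff (a : PowerSeries ℂ) :
    IsLocalRing.residue (PowerSeries ℂ) a = 0 ↔ PowerSeries.constantCoeff a = 0 := by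
  rw [IsLocalRing.residue_eq_zero_iff, mem_maximalIdeal_iff_constantCoeff]

theorem X_pow_dvd_iff_le_order {n : ℕ} {φ : PowerSeries ℂ} :
    PowerSeries.X ^ n ∣ φ ↔ (n : ℕ∞) ≤ φ.order := by
  rw [PowerSeries.X_pow_dvd_iff]
  exact ⟨PowerSeries.nat_le_order φ n, fun h m hm =>
    PowerSeries.coeff_of_lt_order m (lt_of_lt_of_le (by exact_mod_cast hm) h)⟩

/-- The base change `t ↦ t ^ N` of `ℂ⟦t⟧`. -/
def ramify (N : ℕ) (hN : N ≠ 0) : PowerSeries ℂ →+* PowerSeries ℂ :=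
  (PowerSeries.expand N hN).toRingHom

theorem ramify_apply (N : ℕ) (hN : N ≠ 0) (φ : PowerSeries ℂ) :
    ramify N hN φ = PowerSeries.expand N hN φ := rfl

/-- A *distinguished* (Weierstrass) polynomial over `ℂ⟦t⟧`. -/
abbrev Distinguished (w : Polynomial (PowerSeries ℂ)) : Prop :=
  w.IsDistinguishedAt (IsLocalRing.maximalIdeal (PowerSeries ℂ))

theorem Distinguished.map_residue_ne_zero {w : Polynomial (PowerSeries ℂ)}
    (hw : Distinguished w) :
    PowerSeries.map (IsLocalRing.residue (PowerSeries ℂ)) (w : PowerSeries (PowerSeries ℂ)) ≠ 0 := by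
  intro h
  have := congrArg (PowerSeries.coeff w.natDegree) h
  simp [hw.monic] at this

theorem Distinguished.order_map_residue {w : Polynomial (PowerSeries ℂ)}
    (hw : Distinguished w) :
    (PowerSeries.map (IsLocalRing.residue (PowerSeries ℂ))
      (w : PowerSeries (PowerSeries ℂ))).order = w.natDegree := by
  rw [PowerSeries.order_eq_nat]
  constructor
  · simp [hw.monic]
  · intro i hi
    have := hw.mem hi
    simpa [IsLocalRing.residue_eq_zero_iff] using this

theorem exists_distinguished_mul_unit {g : PowerSeries (PowerSeries ℂ)} {m : ℕ}
    (hlow : ∀ i < m, PowerSeries.constantCoeff (PowerSeries.coeff i g) = 0)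
    (hm : PowerSeries.constantCoeff (PowerSeries.coeff m g) ≠ 0) :
    ∃ (w : Polynomial (PowerSeries ℂ)) (h : PowerSeries (PowerSeries ℂ)),
      Distinguished w ∧ w.natDegree = m ∧ IsUnit h ∧ g = w * h := by
  have ho : (PowerSeries.map (IsLocalRing.residue (PowerSeries ℂ)) g).order = m := by
    rw [PowerSeries.order_eq_nat]
    constructor
    · rwa [PowerSeries.coeff_map, Ne, residue_eq_zero_iff_constantCoeff]
    · intro i hi
      rw [PowerSeries.coeff_map, residue_eq_zero_iff_constantCoeff]
      exact hlow i hi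
  have hg : PowerSeries.map (IsLocalRing.residue (PowerSeries ℂ)) g ≠ 0 := by
    intro h
    rw [h] at ho
    simp at ho
  obtain ⟨w, h, H⟩ := PowerSeries.exists_isWeierstrassFactorization hg
  refine ⟨w, h, H.isDistinguishedAt, ?_, H.isUnit, H.eq_mul⟩
  rw [H.natDegree_eq_toNat_order_map, ho]
  rfl

/-- Division by a distinguished polynomial. -/
theorem Distinguished.exists_division {w : Polynomial (PowerSeries ℂ)} (hw : Distinguished w)
    (g : PowerSeries (PowerSeries ℂ)) :
    ∃ (q : PowerSeries (PowerSeries ℂ)) (r : Polynomial (PowerSeries ℂ)),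
      r.degree < w.natDegree ∧ g = w * q + r := by
  obtain ⟨q, r, H⟩ := PowerSeries.exists_isWeierstrassDivision g hw.map_residue_ne_zero
  refine ⟨q, r, ?_, H.eq_mul_add⟩
  have := H.degree_lt
  change r.degree < ((PowerSeries.map (IsLocalRing.residue (PowerSeries ℂ)) _).order.toNat : ℕ) at this
  rw [hw.order_map_residue] at this
  simpa using this

theorem Distinguished.dvd_of_coe_dvd {w p : Polynomial (PowerSeries ℂ)} (hw : Distinguished w)
    (h : (w : PowerSeries (PowerSeries ℂ)) ∣ p) : w ∣ p := by
  obtain ⟨q, hq⟩ := h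
  have hdeg : ∀ r : Polynomial (PowerSeries ℂ), r.degree < w.degree → r.degree <
      (PowerSeries.map (IsLocalRing.residue (PowerSeries ℂ))
        (w : PowerSeries (PowerSeries ℂ))).order.toNat := by
    intro r hr
    rw [hw.order_map_residue]
    rw [Polynomial.degree_eq_natDegree hw.monic.ne_zero] at hr
    simpa using hr
  have H1 : PowerSeries.IsWeierstrassDivision (p : PowerSeries (PowerSeries ℂ)) w q 0 :=
    ⟨hdeg 0 (by simp [Polynomial.degree_eq_natDegree hw.monic.ne_zero]), by simpa using hq⟩
  have H2 : PowerSeries.IsWeierstrassDivision (p : PowerSeries (PowerSeries ℂ)) w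
      ((p /ₘ w : Polynomial (PowerSeries ℂ)) : PowerSeries (PowerSeries ℂ)) (p %ₘ w) :=
    ⟨hdeg _ (Polynomial.degree_modByMonic_lt p hw.monic), by
      conv_lhs => rw [← Polynomial.modByMonic_add_div p w]
      push_cast
      ring⟩
  have := (H1.elim hw.map_residue_ne_zero H2).2
  rwa [eq_comm, Polynomial.modByMonic_eq_zero_iff_dvd hw.monic] at this

/-- A form of Hensel's lemma: a polynomial whose reduction vanishes to order `m` at the origin has
a distinguished factor of degree `m`. -/
theorem exists_distinguished_dvd {p : Polynomial (PowerSeries ℂ)} {m : ℕ}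
    (hlow : ∀ i < m, PowerSeries.constantCoeff (p.coeff i) = 0)
    (hm : PowerSeries.constantCoeff (p.coeff m) ≠ 0) :
    ∃ w : Polynomial (PowerSeries ℂ), Distinguished w ∧ w.natDegree = m ∧ w ∣ p := by
  obtain ⟨w, h, hw, hd, -, e⟩ := exists_distinguished_mul_unit
    (g := (p : PowerSeries (PowerSeries ℂ))) (m := m) (by simpa using hlow) (by simpa using hm)
  exact ⟨w, hw, hd, hw.dvd_of_coe_dvd ⟨h, e⟩⟩

theorem Distinguished.map_constantCoeff {w : Polynomial (PowerSeries ℂ)} (hw : Distinguished w) :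
    w.map PowerSeries.constantCoeff = Polynomial.X ^ w.natDegree := by
  ext i
  rw [Polynomial.coeff_map, Polynomial.coeff_X_pow]
  rcases lt_trichotomy i w.natDegree with h | h | h
  · rw [if_neg h.ne, ← mem_maximalIdeal_iff_constantCoeff]
    exact hw.mem h
  · rw [if_pos h, h, hw.monic.coeff_natDegree, map_one]
  · rw [if_neg h.ne', Polynomial.coeff_eq_zero_of_natDegree_lt h, map_zero]

/-- The Tschirnhausen transformation kills the second coefficient. -/
theorem coeff_taylor_pred {w : Polynomial (PowerSeries ℂ)} (hw : w.Monic) {k : ℕ}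
    (hk : w.natDegree = k + 1) :
    (Polynomial.taylor (-(PowerSeries.C ((k + 1 : ℂ)⁻¹) * w.coeff k)) w).coeff k = 0 := by
  have h1 : (Polynomial.hasseDeriv k w).natDegree < 2 := by
    have := Polynomial.natDegree_hasseDeriv_le w k
    omega
  rw [Polynomial.taylor_coeff, Polynomial.eval_eq_sum_range' h1]
  simp only [Finset.sum_range_succ, Finset.sum_range_zero, Polynomial.hasseDeriv_coeff]
  have h2 : w.coeff (1 + k) = 1 := by
    rw [add_comm, ← hk]; exact hw
  have h3 : (1 + k).choose k = k + 1 := by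
    rw [add_comm 1 k]; exact Nat.choose_succ_self_right k
  have h4 : (((k + 1 : ℕ) : PowerSeries ℂ)) * PowerSeries.C ((k + 1 : ℂ)⁻¹) = 1 := by
    rw [← map_natCast (PowerSeries.C (R := ℂ)), ← map_mul]
    have : ((k : ℂ) + 1) ≠ 0 := Nat.cast_add_one_ne_zero k
    push_cast
    rw [mul_inv_cancel₀ this, map_one]
  rw [h2, h3]
  simp only [zero_add, Nat.choose_self, pow_zero, pow_one, mul_one, Nat.cast_one, one_mul]
  linear_combination (-w.coeff k) * h4

/-- A monic complex polynomial whose second coefficient vanishes, but which is not a power of the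
variable, has a root that is not its only one. -/
theorem exists_rootMultiplicity_lt {P : Polynomial ℂ} (hP : P.Monic) {k i : ℕ}
    (hk : P.natDegree = k + 1) (h0 : P.coeff k = 0) (hi : i ≤ k) (hne : P.coeff i ≠ 0) :
    ∃ c, 0 < P.rootMultiplicity c ∧ P.rootMultiplicity c < k + 1 := by
  obtain ⟨c, hc⟩ := IsAlgClosed.exists_root P
    (by rw [Polynomial.degree_eq_natDegree hP.ne_zero, hk]; exact_mod_cast Nat.succ_ne_zero k)
  refine ⟨c, (Polynomial.rootMultiplicity_pos hP.ne_zero).2 hc, ?_⟩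
  by_contra! hcon
  have hd : (Polynomial.X - Polynomial.C c) ^ (k + 1) ∣ P :=
    (pow_dvd_pow _ hcon).trans (Polynomial.pow_rootMultiplicity_dvd P c)
  have e : (Polynomial.X - Polynomial.C c) ^ (k + 1) = P :=
    (Polynomial.eq_of_monic_of_dvd_of_natDegree_le ((Polynomial.monic_X_sub_C c).pow _) hP hd
      (by simp [hk])).symm
  have h1 : P.coeff k = -((k + 1 : ℕ) : ℂ) * c := by
    rw [← e, sub_eq_add_neg, ← Polynomial.C_neg, Polynomial.coeff_X_add_C_pow]
    simp
    ring
  have hc0 : c = 0 := by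
    rw [h0, eq_comm, mul_eq_zero, neg_eq_zero, Nat.cast_eq_zero] at h1
    simpa using h1
  apply hne
  rw [← e, hc0]
  simp [Polynomial.coeff_X_pow]
  omega

/-- Rescaling along the first edge of the Newton polygon: after `t ↦ t ^ s`, `y ↦ t ^ r * z`, a
distinguished polynomial becomes `t ^ (r * k)` times a monic polynomial whose reduction is not a
power of `z`. -/
theorem exists_newton_scaling {w : Polynomial (PowerSeries ℂ)} (hw : Distinguished w) {i₀ : ℕ}
    (hi₀ : i₀ < w.natDegree) (hne : w.coeff i₀ ≠ 0) :
    ∃ (s : ℕ) (hs : s ≠ 0) (r : ℕ) (W : Polynomial (PowerSeries ℂ)) (i : ℕ),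
      0 < r ∧ W.Monic ∧ W.natDegree = w.natDegree ∧ i < w.natDegree ∧
      PowerSeries.constantCoeff (W.coeff i) ≠ 0 ∧
      ∀ j, j ≤ w.natDegree → PowerSeries.expand s hs (w.coeff j) =
        PowerSeries.X ^ (r * (w.natDegree - j)) * W.coeff j := by
  classical
  set k := w.natDegree with hk
  -- the point of the Newton polygon on its first edge
  let S := (Finset.range k).filter fun i => w.coeff i ≠ 0
  obtain ⟨i, hiS, hmin⟩ := S.exists_min_image
    (fun i => ((w.coeff i).order.toNat : ℚ) / ((k - i : ℕ) : ℚ))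
    ⟨i₀, by simp [S, hi₀, hne]⟩
  obtain ⟨hik, hi0⟩ : i < k ∧ w.coeff i ≠ 0 := by simpa [S] using hiS
  set s := k - i with hsdef
  set r := (w.coeff i).order.toNat with hrdef
  have hs : s ≠ 0 := by omega
  have hoi : (w.coeff i).order = r := (PowerSeries.coe_toNat_order hi0).symm
  have hr : 0 < r := by
    rcases Nat.eq_zero_or_pos r with h | h
    · exfalso
      have h1 := PowerSeries.coeff_order hi0
      have h2 := (mem_maximalIdeal_iff_constantCoeff _).1 (hw.mem hik)
      rw [← hrdef, h] at h1
      exact h1 (by simpa using h2)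
    · exact h
  have key : ∀ j, j ≤ k → ∃ c : PowerSeries ℂ,
      PowerSeries.expand s hs (w.coeff j) = PowerSeries.X ^ (r * (k - j)) * c := by
    intro j hj
    by_cases hz : w.coeff j = 0
    · exact ⟨0, by simp [hz]⟩
    rcases hj.lt_or_eq with hjk | rfl
    swap
    · exact ⟨PowerSeries.expand s hs (w.coeff k), by simp⟩
    have h1 := hmin j (by simp [S, hjk, hz])
    have h2 : (0 : ℚ) < (k - j : ℕ) := by exact_mod_cast Nat.sub_pos_of_lt hjk
    have h3 : (0 : ℚ) < (s : ℕ) := by exact_mod_cast Nat.pos_of_ne_zero hs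
    rw [div_le_div_iff₀ h3 h2] at h1
    have h4 : r * (k - j) ≤ (w.coeff j).order.toNat * s := by exact_mod_cast h1
    have h5 : PowerSeries.X ^ (r * (k - j)) ∣ PowerSeries.expand s hs (w.coeff j) := by
      rw [X_pow_dvd_iff_le_order]
      rw [PowerSeries.order_expand, ← PowerSeries.coe_toNat_order hz, nsmul_eq_mul]
      rw [mul_comm _ s] at h4
      exact_mod_cast h4
    exact h5
  choose! c hc using key
  have hck : c k = 1 := by
    have := hc k le_rfl
    rw [show w.coeff k = 1 from hw.monic] at this
    simpa using this.symm
  have hXne : ∀ n : ℕ, (PowerSeries.X : PowerSeries ℂ) ^ n ≠ 0 := fun n =>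
    pow_ne_zero _ PowerSeries.X_ne_zero
  let W : Polynomial (PowerSeries ℂ) := ∑ j ∈ Finset.range (k + 1), Polynomial.monomial j (c j)
  have hWc : ∀ j, j ≤ k → W.coeff j = c j := by
    intro j hj
    simp only [W, Polynomial.finsetSum_coeff, Polynomial.coeff_monomial]
    rw [Finset.sum_ite_eq' _ j, if_pos (by simpa using Nat.lt_succ_of_le hj)]
  have hWd : W.natDegree ≤ k := by
    refine Polynomial.natDegree_sum_le_of_forall_le _ _ fun j hj => ?_
    exact (Polynomial.natDegree_monomial_le _).trans (Nat.lt_succ_iff.1 (Finset.mem_range.1 hj))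
  have hWm : W.Monic := Polynomial.monic_of_natDegree_le_of_coeff_eq_one k hWd
    ((hWc k le_rfl).trans hck)
  refine ⟨s, hs, r, W, i, hr, hWm, ?_, hik, ?_, fun j hj => by rw [hWc j hj, hc j hj]⟩
  · refine le_antisymm hWd ?_
    apply Polynomial.le_natDegree_of_ne_zero
    rw [hWc k le_rfl, hck]
    exact one_ne_zero
  · rw [hWc i hik.le]
    intro h0
    have h1 : PowerSeries.X ∣ c i := PowerSeries.X_dvd_iff.2 h0
    have h2 : PowerSeries.X ^ (r * s + 1) ∣ PowerSeries.expand s hs (w.coeff i) := by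
      rw [hc i hik.le, pow_succ]
      exact mul_dvd_mul_left _ h1
    rw [X_pow_dvd_iff_le_order, PowerSeries.order_expand, hoi, nsmul_eq_mul] at h2
    have h3 : r * s + 1 ≤ s * r := by exact_mod_cast h2
    rw [mul_comm] at h3
    omega

/-- The Newton-Puiseux theorem: after a ramified base change `t ↦ t ^ N`, a distinguished
polynomial of positive degree has a root of positive order. -/
theorem Distinguished.exists_root {w : Polynomial (PowerSeries ℂ)} (hw : Distinguished w)
    (hpos : 0 < w.natDegree) :
    ∃ (N : ℕ) (hN : N ≠ 0) (ψ : PowerSeries ℂ), PowerSeries.constantCoeff ψ = 0 ∧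
      (w.map (ramify N hN)).eval ψ = 0 := by
  induction hd : w.natDegree using Nat.strong_induction_on generalizing w with
  | _ d ih =>
  obtain ⟨k, rfl⟩ : ∃ k, d = k + 1 := ⟨d - 1, by omega⟩
  -- the Tschirnhausen transformation
  set a : PowerSeries ℂ := -(PowerSeries.C ((k + 1 : ℂ)⁻¹) * w.coeff k) with ha
  set v := Polynomial.taylor a w with hv
  have ha0 : PowerSeries.constantCoeff a = 0 := by
    have := (mem_maximalIdeal_iff_constantCoeff _).1 (hw.mem (n := k) (by omega))
    simp [ha, this]
  have hvm : v.Monic := by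
    rw [Polynomial.Monic, hv, Polynomial.leadingCoeff_taylor]; exact hw.monic
  have hvd : v.natDegree = k + 1 := by rw [hv, Polynomial.natDegree_taylor, hd]
  have hvdist : Distinguished v := by
    have h1 : v.map PowerSeries.constantCoeff = Polynomial.X ^ (k + 1) := by
      rw [hv, Polynomial.taylor_apply, Polynomial.map_comp, hw.map_constantCoeff, hd]
      simp [ha0]
    refine ⟨⟨fun {n} hn => ?_⟩, hvm⟩
    rw [mem_maximalIdeal_iff_constantCoeff, ← Polynomial.coeff_map, h1, Polynomial.coeff_X_pow,
      if_neg (by omega)]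
  suffices h : ∃ (N : ℕ) (hN : N ≠ 0) (ψ : PowerSeries ℂ), PowerSeries.constantCoeff ψ = 0 ∧
      (v.map (ramify N hN)).eval ψ = 0 by
    obtain ⟨N, hN, ψ, h0, h1⟩ := h
    refine ⟨N, hN, ψ + PowerSeries.expand N hN a, by simp [h0, ha0], ?_⟩
    rw [hv, Polynomial.taylor_apply, Polynomial.map_comp, Polynomial.eval_comp] at h1
    simpa [ramify_apply] using h1
  by_cases hall : ∀ i < k + 1, v.coeff i = 0
  · refine ⟨1, one_ne_zero, 0, map_zero _, ?_⟩
    rw [← Polynomial.coeff_zero_eq_eval_zero, Polynomial.coeff_map, hall 0 (by omega), map_zero]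
  push Not at hall
  obtain ⟨i₀, hi₀, hne⟩ := hall
  obtain ⟨s, hs, r, W, i, hr, hWm, hWd, hi, hWi, hW⟩ :=
    exists_newton_scaling hvdist (hvd ▸ hi₀) hne
  rw [hvd] at hWd hi hW
  have hWk : W.coeff k = 0 := by
    have h1 := hW k (by omega)
    rw [hv, coeff_taylor_pred hw.monic hd, map_zero, eq_comm, mul_eq_zero] at h1
    exact h1.resolve_left (pow_ne_zero _ PowerSeries.X_ne_zero)
  -- a root of the reduction of smaller multiplicity, so that the induction hypothesis applies
  obtain ⟨c, hc0, hck⟩ := exists_rootMultiplicity_lt (P := W.map PowerSeries.constantCoeff)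
    (hWm.map _) (by rw [hWm.natDegree_map, hWd]) (by rw [Polynomial.coeff_map, hWk, map_zero])
    (Nat.lt_succ_iff.1 hi) (by rwa [Polynomial.coeff_map])
  set m := (W.map PowerSeries.constantCoeff).rootMultiplicity c with hm
  -- split off the roots reducing to `c`
  set U := Polynomial.taylor (PowerSeries.C c) W with hU
  have hUmap : U.map PowerSeries.constantCoeff =
      Polynomial.taylor c (W.map PowerSeries.constantCoeff) := by
    rw [hU, Polynomial.taylor_apply, Polynomial.taylor_apply, Polynomial.map_comp]
    simp
  have hUmult : ∃ Q : Polynomial ℂ, Q.coeff 0 ≠ 0 ∧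
      U.map PowerSeries.constantCoeff = Polynomial.X ^ m * Q := by
    obtain ⟨Q, hQ, hQc⟩ := Polynomial.exists_eq_pow_rootMultiplicity_mul_and_not_dvd
      (W.map PowerSeries.constantCoeff) (hWm.map _).ne_zero c
    refine ⟨Polynomial.taylor c Q, ?_, ?_⟩
    · rw [Polynomial.taylor_coeff_zero]
      rwa [Polynomial.dvd_iff_isRoot] at hQc
    · rw [hUmap]
      conv_lhs => rw [hQ, Polynomial.taylor_mul, Polynomial.taylor_pow]
      simp [← hm]
  obtain ⟨Q, hQ0, hQ⟩ := hUmult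
  obtain ⟨u, hu, hud, huU⟩ := exists_distinguished_dvd (p := U) (m := m)
    (fun j hj => by
      rw [← Polynomial.coeff_map, hQ, Polynomial.coeff_X_pow_mul', if_neg (by omega)])
    (by rw [← Polynomial.coeff_map, hQ, Polynomial.coeff_X_pow_mul', if_pos le_rfl]; simpa using hQ0)
  obtain ⟨N, hN, ψ, hψ0, hψ⟩ := ih m hck hu (by omega) hud
  set e : PowerSeries ℂ →+* PowerSeries ℂ := ramify N hN with he
  have hUψ : (U.map e).eval ψ = 0 := by
    obtain ⟨t, ht⟩ := huU
    rw [ht, Polynomial.map_mul, Polynomial.eval_mul, hψ, zero_mul]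
  set z := ψ + PowerSeries.C c with hz
  have hWz : (W.map e).eval z = 0 := by
    rw [hU, Polynomial.taylor_apply, Polynomial.map_comp, Polynomial.eval_comp] at hUψ
    have h1 : ramify N hN (PowerSeries.C c) = PowerSeries.C c := PowerSeries.expand_C N hN c
    simpa [he, hz, h1] using hUψ
  -- undo the scaling: `y = t ^ (N * r) * z` once `t` is replaced by `t ^ (N * s)`
  have heX : e PowerSeries.X = PowerSeries.X ^ N := by simp [he, ramify_apply]
  refine ⟨N * s, mul_ne_zero hN hs, PowerSeries.X ^ (N * r) * z, ?_, ?_⟩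
  · have : N * r ≠ 0 := mul_ne_zero hN hr.ne'
    simp [this]
  · rw [Polynomial.eval_map, Polynomial.eval₂_eq_sum_range, hvd]
    rw [Polynomial.eval_map, Polynomial.eval₂_eq_sum_range, hWd] at hWz
    calc _ = ∑ j ∈ Finset.range (k + 1 + 1),
          PowerSeries.X ^ (N * r * (k + 1)) * (e (W.coeff j) * z ^ j) := by
          refine Finset.sum_congr rfl fun j hj => ?_
          have hj' : j ≤ k + 1 := Nat.lt_succ_iff.1 (Finset.mem_range.1 hj)
          have h1 : ramify (N * s) (mul_ne_zero hN hs)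
              (v.coeff j) = e (PowerSeries.expand s hs (v.coeff j)) := by
            exact PowerSeries.expand_mul N hN s hs _
          rw [h1, hW j hj', map_mul, map_pow, heX, mul_pow, ← pow_mul, ← pow_mul]
          have h2 : N * r * (k + 1) = N * (r * (k + 1 - j)) + N * r * j := by
            rw [mul_assoc N r j, ← mul_add, ← mul_add, Nat.sub_add_cancel hj', mul_assoc]
          rw [h2, pow_add]
          ring
      _ = 0 := by rw [← Finset.mul_sum, hWz, mul_zero]

/-! ### Newton-Puiseux series as power series in a root of `x` -/

/-- All exponents of `η` lie in `(1 / N) ℕ`. -/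
def HasDenom (N : ℕ) (η : GenSeries) : Prop := ∀ q ∈ η.support, ∃ k : ℕ, q = (k : ℚ) / N

/-- The homomorphism `ℕ → ℚ`, `k ↦ k / N`. -/
def divHom (N : ℕ) : ℕ →+ ℚ where
  toFun k := (k : ℚ) / N
  map_zero' := by simp
  map_add' a b := by push_cast; ring

theorem divHom_apply (N k : ℕ) : divHom N k = (k : ℚ) / N := rfl

theorem divHom_injective {N : ℕ} (hN : N ≠ 0) : Function.Injective (divHom N) := by
  intro a b h
  have : (N : ℚ) ≠ 0 := by exact_mod_cast hN
  simpa [divHom_apply, this] using h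

theorem divHom_le_iff {N : ℕ} (hN : N ≠ 0) (a b : ℕ) : divHom N a ≤ divHom N b ↔ a ≤ b := by
  have : (0 : ℚ) < N := by exact_mod_cast Nat.pos_of_ne_zero hN
  simp [divHom_apply, div_le_div_iff_of_pos_right this]

/-- The embedding `ψ ↦ ψ(x ^ (1 / N))` of `ℂ⟦t⟧` into the series with rational exponents. -/
def rootEmb (N : ℕ) (hN : N ≠ 0) : PowerSeries ℂ →+* GenSeries :=
  (HahnSeries.embDomainRingHom (divHom N) (divHom_injective hN) (divHom_le_iff hN)).comp
    (RingEquiv.toRingHom HahnSeries.toPowerSeries.symm)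

theorem coeff_rootEmb {N : ℕ} (hN : N ≠ 0) (ψ : PowerSeries ℂ) (k : ℕ) :
    (rootEmb N hN ψ).coeff ((k : ℚ) / N) = PowerSeries.coeff k ψ := by
  have h := HahnSeries.embDomain_coeff
    (f := ⟨⟨divHom N, divHom_injective hN⟩, divHom_le_iff hN _ _⟩)
    (x := HahnSeries.toPowerSeries.symm ψ) (a := k)
  rw [HahnSeries.coeff_toPowerSeries_symm] at h
  exact h

theorem coeff_rootEmb_of_ne {N : ℕ} (hN : N ≠ 0) (ψ : PowerSeries ℂ) {q : ℚ}
    (hq : ∀ k : ℕ, q ≠ (k : ℚ) / N) : (rootEmb N hN ψ).coeff q = 0 := by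
  refine HahnSeries.embDomain_of_notMem_range
    (f := ⟨⟨divHom N, divHom_injective hN⟩, divHom_le_iff hN _ _⟩)
    (x := HahnSeries.toPowerSeries.symm ψ) ?_
  rintro ⟨k, rfl⟩
  exact hq k rfl

theorem rootEmb_injective {N : ℕ} (hN : N ≠ 0) : Function.Injective (rootEmb N hN) := by
  intro a b h
  ext k
  rw [← coeff_rootEmb hN, h, coeff_rootEmb hN]

theorem hasDenom_rootEmb {N : ℕ} (hN : N ≠ 0) (ψ : PowerSeries ℂ) :
    HasDenom N (rootEmb N hN ψ) := by
  intro q hq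
  by_contra! h
  exact hq (coeff_rootEmb_of_ne hN ψ h)

theorem HasDenom.exists_eq_rootEmb {N : ℕ} (hN : N ≠ 0) {η : GenSeries} (h : HasDenom N η) :
    ∃ ψ, rootEmb N hN ψ = η := by
  refine ⟨PowerSeries.mk fun k => η.coeff ((k : ℚ) / N), ?_⟩
  ext q
  by_cases hq : ∃ k : ℕ, q = (k : ℚ) / N
  · obtain ⟨k, rfl⟩ := hq
    rw [coeff_rootEmb, PowerSeries.coeff_mk]
  · push Not at hq
    rw [coeff_rootEmb_of_ne hN _ hq]
    by_contra h0
    obtain ⟨k, hk⟩ := h q (Ne.symm h0)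
    exact hq k hk

theorem HasDenom.mono {N M : ℕ} (hM : M ≠ 0) (hd : N ∣ M) {η : GenSeries} (h : HasDenom N η) :
    HasDenom M η := by
  intro q hq
  obtain ⟨k, rfl⟩ := h q hq
  obtain ⟨c, rfl⟩ := hd
  refine ⟨k * c, ?_⟩
  have hN : (N : ℚ) ≠ 0 := by exact_mod_cast left_ne_zero_of_mul hM
  have hc : (c : ℚ) ≠ 0 := by exact_mod_cast right_ne_zero_of_mul hM
  push_cast
  field_simp

theorem HasDenom.isNewtonPuiseux {N : ℕ} (hN : N ≠ 0) {η : GenSeries} (h : HasDenom N η) :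
    IsNewtonPuiseux η := ⟨N, hN, h⟩

/-- Finitely many Newton-Puiseux series have a common denominator. -/
theorem IsNewtonPuiseux.common {η ξ : GenSeries} (hη : IsNewtonPuiseux η)
    (hξ : IsNewtonPuiseux ξ) : ∃ N : ℕ, N ≠ 0 ∧ HasDenom N η ∧ HasDenom N ξ := by
  obtain ⟨n, hn, h⟩ := hη
  obtain ⟨m, hm, h'⟩ := hξ
  exact ⟨n * m, mul_ne_zero hn hm, HasDenom.mono (mul_ne_zero hn hm) (dvd_mul_right _ _) h,
    HasDenom.mono (mul_ne_zero hn hm) (dvd_mul_left _ _) h'⟩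

theorem HasDenom.add {N : ℕ} (hN : N ≠ 0) {η ξ : GenSeries} (h : HasDenom N η)
    (h' : HasDenom N ξ) : HasDenom N (η + ξ) := by
  obtain ⟨a, rfl⟩ := h.exists_eq_rootEmb hN
  obtain ⟨b, rfl⟩ := h'.exists_eq_rootEmb hN
  rw [← map_add]
  exact hasDenom_rootEmb hN _

theorem HasDenom.sub {N : ℕ} (hN : N ≠ 0) {η ξ : GenSeries} (h : HasDenom N η)
    (h' : HasDenom N ξ) : HasDenom N (η - ξ) := by
  obtain ⟨a, rfl⟩ := h.exists_eq_rootEmb hN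
  obtain ⟨b, rfl⟩ := h'.exists_eq_rootEmb hN
  rw [← map_sub]
  exact hasDenom_rootEmb hN _

theorem HasDenom.mul {N : ℕ} (hN : N ≠ 0) {η ξ : GenSeries} (h : HasDenom N η)
    (h' : HasDenom N ξ) : HasDenom N (η * ξ) := by
  obtain ⟨a, rfl⟩ := h.exists_eq_rootEmb hN
  obtain ⟨b, rfl⟩ := h'.exists_eq_rootEmb hN
  rw [← map_mul]
  exact hasDenom_rootEmb hN _

theorem orderTop_pos_rootEmb_iff {N : ℕ} (hN : N ≠ 0) (ψ : PowerSeries ℂ) :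
    0 < (rootEmb N hN ψ).orderTop ↔ PowerSeries.constantCoeff ψ = 0 := by
  constructor
  · intro h
    have := HahnSeries.coeff_eq_zero_of_lt_orderTop h
    rw [← PowerSeries.coeff_zero_eq_constantCoeff_apply, ← coeff_rootEmb hN]
    simpa using this
  · intro h
    by_cases h0 : rootEmb N hN ψ = 0
    · rw [h0]; simp
    rw [HahnSeries.orderTop_of_ne_zero h0]
    have hmem := Set.IsWF.min_mem (rootEmb N hN ψ).isWF_support
      (HahnSeries.support_nonempty_iff.2 h0)
    obtain ⟨k, hk⟩ := hasDenom_rootEmb hN ψ _ hmem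
    rw [hk] at hmem ⊢
    rcases Nat.eq_zero_or_pos k with rfl | hk0
    · exfalso
      apply hmem
      rw [coeff_rootEmb]
      simpa using h
    · have : (0 : ℚ) < (k : ℚ) / N :=
        div_pos (by exact_mod_cast hk0) (by exact_mod_cast Nat.pos_of_ne_zero hN)
      exact_mod_cast this

theorem algebraMap_eq_rootEmb (a : PowerSeries ℂ) :
    algebraMap (PowerSeries ℂ) GenSeries a = rootEmb 1 one_ne_zero a := by
  rw [HahnSeries.algebraMap_apply']
  ext q
  by_cases hq : ∃ k : ℕ, q = (k : ℚ)
  · obtain ⟨k, rfl⟩ := hq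
    have h := coeff_rootEmb one_ne_zero a k
    rw [Nat.cast_one, div_one] at h
    rw [h]
    simpa using HahnSeries.ofPowerSeries_apply_coeff (Γ := ℚ) a k
  · push Not at hq
    rw [coeff_rootEmb_of_ne one_ne_zero a (by simpa using hq)]
    rw [Algebra.algebraMap_self_apply, HahnSeries.ofPowerSeries_apply]
    refine HahnSeries.embDomain_of_notMem_range ?_
    rintro ⟨k, rfl⟩
    exact hq k rfl

theorem rootEmb_ramify {N : ℕ} (hN : N ≠ 0) (a : PowerSeries ℂ) :
    rootEmb N hN (ramify N hN a) = algebraMap (PowerSeries ℂ) GenSeries a := by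
  rw [algebraMap_eq_rootEmb]
  have hN' : (N : ℚ) ≠ 0 := by exact_mod_cast hN
  ext q
  by_cases hq : ∃ k : ℕ, q = (k : ℚ) / N
  · obtain ⟨k, rfl⟩ := hq
    rw [coeff_rootEmb, ramify_apply, PowerSeries.coeff_expand]
    split_ifs with h
    · obtain ⟨c, rfl⟩ := h
      have h1 := coeff_rootEmb one_ne_zero a c
      rw [Nat.mul_div_cancel_left _ (Nat.pos_of_ne_zero hN), ← h1]
      congr 1
      push_cast
      field_simp
    · rw [coeff_rootEmb_of_ne]
      intro c hc
      apply h
      refine ⟨c, ?_⟩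
      rw [Nat.cast_one, div_one, div_eq_iff hN'] at hc
      rw [mul_comm]
      exact_mod_cast hc
  · push Not at hq
    rw [coeff_rootEmb_of_ne hN _ hq, coeff_rootEmb_of_ne]
    intro k hk
    apply hq (N * k)
    rw [hk]
    push_cast
    field_simp

/-! ### Evaluation of series in two variables -/

/-- Monomials in two variables as pairs of exponents. -/
def expEquiv : ℕ × ℕ ≃ (Fin 2 →₀ ℕ) where
  toFun p := Finsupp.single 0 p.1 + Finsupp.single 1 p.2
  invFun d := (d 0, d 1)
  left_inv p := by simp
  right_inv d := by ext i; fin_cases i <;> simp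

theorem expEquiv_apply (p : ℕ × ℕ) :
    expEquiv p = Finsupp.single 0 p.1 + Finsupp.single 1 p.2 := rfl

theorem coeff_evalAt (f : FormalRing) {η : GenSeries} (hη : 0 < η.orderTop) (q : ℚ) :
    (evalAt f η).coeff q = ∑ᶠ p : ℕ × ℕ, MvPowerSeries.coeff (expEquiv p) f *
      ((HahnSeries.single (1 : ℚ) (1 : ℂ)) ^ p.1 * η ^ p.2).coeff q := by
  rw [evalAt, HahnSeries.SummableFamily.coeff_hsum]
  have h1 : 0 < (HahnSeries.single (1 : ℚ) (1 : ℂ)).orderTop := by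
    rw [HahnSeries.orderTop_single one_ne_zero]
    exact_mod_cast one_pos
  refine finsum_congr fun p => ?_
  rw [HahnSeries.SummableFamily.smulFamily_toFun, HahnSeries.SummableFamily.mul_toFun,
    HahnSeries.SummableFamily.powers_of_orderTop_pos h1,
    HahnSeries.SummableFamily.powers_of_orderTop_pos hη]
  rfl

theorem rootEmb_X_pow {N : ℕ} (hN : N ≠ 0) :
    rootEmb N hN (PowerSeries.X ^ N) = HahnSeries.single (1 : ℚ) (1 : ℂ) := by
  have h : ramify N hN PowerSeries.X = PowerSeries.X ^ N := by
    rw [ramify_apply, PowerSeries.expand_X]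
  rw [← h, rootEmb_ramify, HahnSeries.algebraMap_apply', Algebra.algebraMap_self_apply,
    HahnSeries.ofPowerSeries_X]

theorem hasSubst_pair {N : ℕ} (hN : N ≠ 0) {ψ : PowerSeries ℂ}
    (hψ : PowerSeries.constantCoeff ψ = 0) :
    MvPowerSeries.HasSubst (![PowerSeries.X ^ N, ψ] : Fin 2 → MvPowerSeries Unit ℂ) := by
  apply MvPowerSeries.hasSubst_of_constantCoeff_zero
  intro i
  fin_cases i
  · change PowerSeries.constantCoeff ((PowerSeries.X : PowerSeries ℂ) ^ N) = 0
    simp [hN]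
  · exact hψ

/-- Evaluation at `ψ(x ^ (1 / N))` is the substitution `x = t ^ N`, `y = ψ(t)`. -/
theorem evalAt_rootEmb {N : ℕ} (hN : N ≠ 0) {ψ : PowerSeries ℂ}
    (hψ : PowerSeries.constantCoeff ψ = 0) (f : FormalRing) :
    evalAt f (rootEmb N hN ψ) = rootEmb N hN (MvPowerSeries.subst
      (![PowerSeries.X ^ N, ψ] : Fin 2 → MvPowerSeries Unit ℂ) f) := by
  ext q
  rw [coeff_evalAt f ((orderTop_pos_rootEmb_iff hN ψ).2 hψ)]
  simp only [← rootEmb_X_pow hN, ← map_pow, ← map_mul]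
  by_cases hq : ∃ k : ℕ, q = (k : ℚ) / N
  · obtain ⟨k, rfl⟩ := hq
    rw [coeff_rootEmb]
    simp only [coeff_rootEmb]
    rw [PowerSeries.coeff, MvPowerSeries.coeff_subst (hasSubst_pair hN hψ),
      ← finsum_comp_equiv expEquiv]
    refine finsum_congr fun p => ?_
    rw [smul_eq_mul]
    congr 2
    rw [Finsupp.prod_fintype _ _ (by simp), Fin.prod_univ_two]
    simp [expEquiv_apply]
  · push Not at hq
    rw [coeff_rootEmb_of_ne hN _ hq]
    simp only [coeff_rootEmb_of_ne hN _ hq, mul_zero, finsum_zero]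

/-- The Newton-Puiseux series of positive order: those at which a series in two variables can be
evaluated. -/
def IsPosNP (η : GenSeries) : Prop := IsNewtonPuiseux η ∧ 0 < η.orderTop

theorem IsPosNP.exists_rootEmb {η : GenSeries} (h : IsPosNP η) :
    ∃ (N : ℕ) (hN : N ≠ 0) (ψ : PowerSeries ℂ), PowerSeries.constantCoeff ψ = 0 ∧
      rootEmb N hN ψ = η := by
  obtain ⟨⟨N, hN, hd⟩, ho⟩ := h
  obtain ⟨ψ, rfl⟩ := HasDenom.exists_eq_rootEmb hN hd
  exact ⟨N, hN, ψ, (orderTop_pos_rootEmb_iff hN ψ).1 ho, rfl⟩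

/-- Evaluation at a Newton-Puiseux series of positive order is a ring homomorphism. -/
theorem IsPosNP.exists_ringHom {η : GenSeries} (h : IsPosNP η) :
    ∃ φ : FormalRing →+* GenSeries, ∀ f, evalAt f η = φ f := by
  obtain ⟨N, hN, ψ, hψ, rfl⟩ := h.exists_rootEmb
  exact ⟨(rootEmb N hN).comp
    (MvPowerSeries.substAlgHom (R := ℂ) (hasSubst_pair hN hψ)).toRingHom,
    fun f => by
      rw [evalAt_rootEmb hN hψ]
      simp [MvPowerSeries.coe_substAlgHom]⟩

/-- Evaluation at `η`, as a ring homomorphism. -/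
def evalHom (η : GenSeries) (h : IsPosNP η) : FormalRing →+* GenSeries := h.exists_ringHom.choose

theorem evalHom_apply {η : GenSeries} (h : IsPosNP η) (f : FormalRing) :
    evalHom η h f = evalAt f η := (h.exists_ringHom.choose_spec f).symm

/-! ### Series in two variables as iterated power series -/

/-- An iterated power series in `ℂ⟦x⟧⟦y⟧` as a series in two variables. -/
def iterFun (g : PowerSeries (PowerSeries ℂ)) : FormalRing :=
  fun d => PowerSeries.coeff (d 0) (PowerSeries.coeff (d 1) g)

theorem coeff_iterFun (g : PowerSeries (PowerSeries ℂ)) (d : Fin 2 →₀ ℕ) :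
    MvPowerSeries.coeff d (iterFun g) = PowerSeries.coeff (d 0) (PowerSeries.coeff (d 1) g) := rfl

/-- `ℂ⟦x, y⟧ = ℂ⟦x⟧⟦y⟧`. -/
def iterEquiv : PowerSeries (PowerSeries ℂ) ≃+* FormalRing where
  toFun := iterFun
  invFun f := PowerSeries.mk fun j => PowerSeries.mk fun i => MvPowerSeries.coeff (expEquiv (i, j)) f
  left_inv g := by
    ext j i
    rw [PowerSeries.coeff_mk, PowerSeries.coeff_mk, coeff_iterFun]
    simp [expEquiv_apply]
  right_inv f := by
    ext d
    rw [coeff_iterFun, PowerSeries.coeff_mk, PowerSeries.coeff_mk]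
    congr 2
    exact expEquiv.right_inv d
  map_add' g h := by
    ext d
    rw [map_add]
    simp only [coeff_iterFun, map_add]
  map_mul' g h := by
    classical
    ext d
    simp only [MvPowerSeries.coeff_mul, coeff_iterFun]
    rw [PowerSeries.coeff_mul, map_sum]
    simp only [PowerSeries.coeff_mul]
    rw [← Finset.sum_product']
    refine Finset.sum_nbij' (fun p => (expEquiv (p.2.1, p.1.1), expEquiv (p.2.2, p.1.2)))
      (fun p => ((p.1 1, p.2 1), (p.1 0, p.2 0))) ?_ ?_ ?_ ?_ ?_
    · rintro ⟨⟨a, b⟩, ⟨a', b'⟩⟩ hp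
      simp only [Finset.mem_product, Finset.HasAntidiagonal.mem_antidiagonal] at hp
      rw [Finset.HasAntidiagonal.mem_antidiagonal]
      ext i
      fin_cases i
      · simpa [expEquiv_apply] using hp.2
      · simpa [expEquiv_apply] using hp.1
    · rintro ⟨a, b⟩ hp
      rw [Finset.HasAntidiagonal.mem_antidiagonal] at hp
      simp [← hp]
    · rintro ⟨⟨a, b⟩, ⟨a', b'⟩⟩ -
      simp [expEquiv_apply]
    · rintro ⟨a, b⟩ -
      exact Prod.ext (expEquiv.right_inv a) (expEquiv.right_inv b)
    · rintro ⟨⟨a, b⟩, ⟨a', b'⟩⟩ -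
      simp [expEquiv_apply]

theorem coeff_iterEquiv (g : PowerSeries (PowerSeries ℂ)) (d : Fin 2 →₀ ℕ) :
    MvPowerSeries.coeff d (iterEquiv g) = PowerSeries.coeff (d 0) (PowerSeries.coeff (d 1) g) := rfl

theorem polyToSeries_eq (p : Polynomial (PowerSeries ℂ)) :
    polyToSeries p = iterEquiv (p : PowerSeries (PowerSeries ℂ)) := by
  ext d
  rw [coeff_iterEquiv, Polynomial.coeff_coe]
  rfl

theorem iterEquiv_C_X :
    iterEquiv (PowerSeries.C (PowerSeries.X : PowerSeries ℂ)) = xCoord := by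
  classical
  ext d
  rw [coeff_iterEquiv, xCoord, MvPowerSeries.coeff_X, PowerSeries.coeff_C]
  by_cases h1 : d 1 = 0
  · rw [if_pos h1, PowerSeries.coeff_X]
    congr 1
    refine propext ⟨fun h => ?_, fun h => by simp [h]⟩
    ext i
    fin_cases i <;> simp [h, h1]
  · rw [if_neg h1, map_zero, if_neg]
    rintro rfl
    simp at h1

theorem evalAt_iterEquiv_C {η : GenSeries} (hη : 0 < η.orderTop) (a : PowerSeries ℂ) :
    evalAt (iterEquiv (PowerSeries.C a)) η = algebraMap (PowerSeries ℂ) GenSeries a := by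
  rw [algebraMap_eq_rootEmb]
  ext q
  rw [coeff_evalAt _ hη]
  simp only [coeff_iterEquiv, expEquiv_apply, PowerSeries.coeff_C, HahnSeries.single_pow]
  have h0 : ∀ p : ℕ × ℕ, p.2 ≠ 0 ∨ q ≠ (p.1 : ℚ) → PowerSeries.coeff
      ((Finsupp.single (0 : Fin 2) p.1 + Finsupp.single 1 p.2 : Fin 2 →₀ ℕ) 0)
      (if (Finsupp.single (0 : Fin 2) p.1 + Finsupp.single 1 p.2 : Fin 2 →₀ ℕ) 1 = 0
        then a else 0) * (HahnSeries.single (p.1 • (1 : ℚ)) ((1 : ℂ) ^ p.1) * η ^ p.2).coeff q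
        = 0 := by
    intro p hp
    by_cases h2 : p.2 = 0
    · have h1 := hp.resolve_left (not_not.2 h2)
      rw [h2, pow_zero, mul_one, HahnSeries.coeff_single_of_ne (by simpa using h1), mul_zero]
    · simp [h2]
  by_cases hq : ∃ k : ℕ, q = (k : ℚ)
  · obtain ⟨k, rfl⟩ := hq
    have h := coeff_rootEmb one_ne_zero a k
    rw [Nat.cast_one, div_one] at h
    rw [h, finsum_eq_single _ (k, 0)]
    · simp
    · rintro ⟨i, j⟩ hp
      apply h0
      by_contra! hcon
      obtain ⟨h1, h2⟩ := hcon
      apply hp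
      ext
      · exact_mod_cast h2.symm
      · exact h1
  · push Not at hq
    rw [coeff_rootEmb_of_ne one_ne_zero a (by simpa using hq)]
    exact finsum_eq_zero_of_forall_eq_zero fun p => h0 p (Or.inr (hq _))

theorem evalAt_iterEquiv_X {η : GenSeries} (hη : 0 < η.orderTop) :
    evalAt (iterEquiv PowerSeries.X) η = η := by
  ext q
  rw [coeff_evalAt _ hη, finsum_eq_single _ (0, 1)]
  · simp [coeff_iterEquiv, expEquiv_apply]
  · rintro ⟨i, j⟩ hp
    have : PowerSeries.coeff i (PowerSeries.coeff j
        (PowerSeries.X : PowerSeries (PowerSeries ℂ))) = 0 := by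
      rw [PowerSeries.coeff_X]
      split_ifs with h
      · rw [PowerSeries.coeff_one, if_neg]
        rintro rfl
        exact hp (by rw [h])
      · exact map_zero _
    simp [coeff_iterEquiv, expEquiv_apply, this]

theorem evalAt_polyToSeries {η : GenSeries} (h : IsPosNP η) (p : Polynomial (PowerSeries ℂ)) :
    evalAt (polyToSeries p) η = Polynomial.aeval η p := by
  have key : ((evalHom η h).comp (iterEquiv.toRingHom.comp
      (Polynomial.coeToPowerSeries.ringHom (R := PowerSeries ℂ)))) =
      (Polynomial.aeval (R := PowerSeries ℂ) η).toRingHom := by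
    refine Polynomial.ringHom_ext (fun a => ?_) ?_
    · rw [RingHom.comp_apply, evalHom_apply]
      change evalAt (iterEquiv ((Polynomial.C a : Polynomial (PowerSeries ℂ)) :
        PowerSeries (PowerSeries ℂ))) η = Polynomial.aeval η (Polynomial.C a)
      rw [Polynomial.aeval_C, Polynomial.coe_C, evalAt_iterEquiv_C h.2]
    · rw [RingHom.comp_apply, evalHom_apply]
      change evalAt (iterEquiv ((Polynomial.X : Polynomial (PowerSeries ℂ)) :
        PowerSeries (PowerSeries ℂ))) η = Polynomial.aeval η Polynomial.X
      rw [Polynomial.aeval_X, Polynomial.coe_X, evalAt_iterEquiv_X h.2]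
  have := DFunLike.congr_fun key p
  rw [polyToSeries_eq, ← evalHom_apply h]
  exact this

theorem polyToSeries_one : polyToSeries 1 = 1 := by simp [polyToSeries_eq]

/-- Restriction to `L`: `f ↦ f(0, y)`. -/
def restrictL : FormalRing →+* PowerSeries ℂ :=
  (PowerSeries.map PowerSeries.constantCoeff).comp iterEquiv.symm.toRingHom

theorem restrictL_iterEquiv (g : PowerSeries (PowerSeries ℂ)) :
    restrictL (iterEquiv g) = PowerSeries.map PowerSeries.constantCoeff g := by
  simp [restrictL]

theorem coeff_restrictL (f : FormalRing) (j : ℕ) :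
    PowerSeries.coeff j (restrictL f) = MvPowerSeries.coeff (expEquiv (0, j)) f := by
  obtain ⟨g, rfl⟩ := iterEquiv.surjective f
  rw [restrictL_iterEquiv, coeff_iterEquiv]
  simp [expEquiv_apply]

theorem restrictL_eq_zero_iff (f : FormalRing) : restrictL f = 0 ↔ xCoord ∣ f := by
  constructor
  · obtain ⟨g, rfl⟩ := iterEquiv.surjective f
    intro h
    rw [restrictL_iterEquiv] at h
    have h1 : ∀ j, ∃ c, PowerSeries.coeff j g = PowerSeries.X * c := fun j => by
      have := congrArg (PowerSeries.coeff j) h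
      rw [PowerSeries.coeff_map, map_zero] at this
      exact PowerSeries.X_dvd_iff.2 this
    choose c hc using h1
    have : g = PowerSeries.C (PowerSeries.X : PowerSeries ℂ) * PowerSeries.mk c := by
      ext1 j
      rw [PowerSeries.coeff_C_mul, PowerSeries.coeff_mk, hc]
    rw [this, map_mul, iterEquiv_C_X]
    exact dvd_mul_right _ _
  · rintro ⟨g, rfl⟩
    rw [map_mul, ← iterEquiv_C_X, restrictL_iterEquiv]
    simp

theorem restrictL_surjective : Function.Surjective restrictL := fun h =>
  ⟨iterEquiv (PowerSeries.map (PowerSeries.C (R := ℂ)) h), by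
    rw [restrictL_iterEquiv]
    ext j
    simp⟩

/-- The Weierstrass preparation theorem for series not divisible by `x`. -/
theorem exists_weierstrass {f : FormalRing} (hf : ¬ xCoord ∣ f) :
    ∃ (w : Polynomial (PowerSeries ℂ)) (u : FormalRing), Distinguished w ∧ IsUnit u ∧
      f = polyToSeries w * u := by
  classical
  rw [← restrictL_eq_zero_iff] at hf
  obtain ⟨g, rfl⟩ := iterEquiv.surjective f
  rw [restrictL_iterEquiv] at hf
  have hex : ∃ m, PowerSeries.constantCoeff (PowerSeries.coeff m g) ≠ 0 := by
    by_contra! h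
    apply hf
    ext j
    simpa using h j
  obtain ⟨w, h, hw, -, hu, e⟩ := exists_distinguished_mul_unit (g := g) (m := Nat.find hex)
    (fun i hi => not_not.1 (Nat.find_min hex hi)) (Nat.find_spec hex)
  exact ⟨w, iterEquiv h, hw, hu.map iterEquiv, by rw [e, map_mul, polyToSeries_eq]⟩

theorem Distinguished.restrictL_eq {w : Polynomial (PowerSeries ℂ)} (hw : Distinguished w) :
    restrictL (polyToSeries w) = PowerSeries.X ^ w.natDegree := by
  rw [polyToSeries_eq, restrictL_iterEquiv]
  have := congrArg (fun p : Polynomial ℂ => (p : PowerSeries ℂ)) hw.map_constantCoeff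
  simpa [Polynomial.polynomial_map_coe] using this

theorem Distinguished.not_xCoord_dvd {w : Polynomial (PowerSeries ℂ)} (hw : Distinguished w) :
    ¬ xCoord ∣ polyToSeries w := by
  rw [← restrictL_eq_zero_iff, hw.restrictL_eq]
  exact pow_ne_zero _ PowerSeries.X_ne_zero

/-- The intersection number with `L` is the degree of the Weierstrass polynomial. -/
theorem Distinguished.intersectionNumber_eq {w : Polynomial (PowerSeries ℂ)}
    (hw : Distinguished w) {u : FormalRing} (hu : IsUnit u) :
    intersectionNumber xCoord (polyToSeries w * u) = w.natDegree := by
  set f := polyToSeries w * u with hf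
  set n := w.natDegree with hn
  have hfr : restrictL f = PowerSeries.X ^ n * restrictL u := by
    rw [hf, map_mul, hw.restrictL_eq]
  -- the quotient is read off from the first `n` coefficients of `g(0, y)`
  let T : FormalRing →ₗ[ℂ] (Fin n → ℂ) :=
    LinearMap.pi fun j => MvPowerSeries.coeff (expEquiv (0, (j : ℕ)))
  have hTapp : ∀ g j, T g j = PowerSeries.coeff (j : ℕ) (restrictL g) := fun g j => by
    rw [coeff_restrictL]; rfl
  have hT : Function.Surjective T := by
    intro v
    obtain ⟨g, hg⟩ := restrictL_surjective
      (PowerSeries.mk fun j => if h : j < n then v ⟨j, h⟩ else 0)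
    refine ⟨g, ?_⟩
    ext j
    rw [hTapp, hg]
    simp
  have hker : LinearMap.ker T = (Ideal.span {xCoord, f}).restrictScalars ℂ := by
    ext g
    rw [LinearMap.mem_ker, Submodule.restrictScalars_mem, Ideal.mem_span_pair]
    have h1 : T g = 0 ↔ PowerSeries.X ^ n ∣ restrictL g := by
      rw [PowerSeries.X_pow_dvd_iff, funext_iff]
      exact ⟨fun h m hm => (hTapp g ⟨m, hm⟩).symm.trans (h ⟨m, hm⟩),
        fun h j => (hTapp g j).trans (h j j.2)⟩
    rw [h1]
    constructor
    · rintro ⟨c, hc⟩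
      obtain ⟨v, hv⟩ := hu
      obtain ⟨c', rfl⟩ := restrictL_surjective c
      have h2 : restrictL (g - (↑v⁻¹ * c') * f) = 0 := by
        have h3 : restrictL (↑v⁻¹ : FormalRing) * restrictL u = 1 := by
          rw [← map_mul, ← hv, Units.inv_mul, map_one]
        rw [map_sub, map_mul, map_mul, hc, hfr]
        linear_combination (-(PowerSeries.X ^ n * restrictL c')) * h3
      obtain ⟨b, hb⟩ := (restrictL_eq_zero_iff _).1 h2
      exact ⟨b, ↑v⁻¹ * c', by linear_combination -hb⟩
    · rintro ⟨a, b, rfl⟩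
      rw [map_add, map_mul, map_mul, (restrictL_eq_zero_iff xCoord).2 dvd_rfl, hfr]
      exact ⟨restrictL b * restrictL u, by ring⟩
  have e : (FormalRing ⧸ Ideal.span {xCoord, f}) ≃ₗ[ℂ] (Fin n → ℂ) :=
    ((Submodule.Quotient.restrictScalarsEquiv ℂ (Ideal.span {xCoord, f})).symm.trans
      (Submodule.quotEquivOfEq _ _ hker.symm)).trans (T.quotKerEquivOfSurjective hT)
  rw [intersectionNumber, e.rank_eq]
  simp

/-- Division of series in two variables by a Weierstrass polynomial. -/
theorem Distinguished.exists_series_division {w : Polynomial (PowerSeries ℂ)}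
    (hw : Distinguished w) (f : FormalRing) :
    ∃ (q : FormalRing) (r : Polynomial (PowerSeries ℂ)), r.degree < w.natDegree ∧
      f = polyToSeries w * q + polyToSeries r := by
  obtain ⟨g, rfl⟩ := iterEquiv.surjective f
  obtain ⟨q, r, hr, e⟩ := hw.exists_division g
  exact ⟨iterEquiv q, r, hr, by rw [e, map_add, map_mul, polyToSeries_eq, polyToSeries_eq]⟩

/-! ### The order of a series -/

theorem ratVal_mono {p q : ℚ} (h : p ≤ q) : ratVal p ≤ ratVal q :=
  ENNReal.ofReal_le_ofReal (by exact_mod_cast h)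

theorem nuX_zero : nuX 0 = ⊤ := by simp [nuX]

theorem nuX_of_ne_zero {η : GenSeries} (h : η ≠ 0) : nuX η = ratVal η.order := by simp [nuX, h]

theorem order_mem_support {η : GenSeries} (h : η ≠ 0) : η.order ∈ η.support := by
  rw [HahnSeries.order_of_ne h]
  exact Set.IsWF.min_mem _ _

theorem le_nuX_iff {η : GenSeries} {a : ℝ≥0∞} : a ≤ nuX η ↔ ∀ q ∈ η.support, a ≤ ratVal q := by
  by_cases h : η = 0
  · simp [h, nuX_zero]
  rw [nuX_of_ne_zero h]
  exact ⟨fun ha q hq => ha.trans (ratVal_mono (HahnSeries.order_le_of_coeff_ne_zero hq)),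
    fun ha => ha _ (order_mem_support h)⟩

theorem nuX_congr {η ξ : GenSeries} (h : η.support = ξ.support) : nuX η = nuX ξ :=
  eq_of_forall_le_iff fun a => by rw [le_nuX_iff, le_nuX_iff, h]

theorem le_nuX_add {η ξ : GenSeries} {a : ℝ≥0∞} (h : a ≤ nuX η) (h' : a ≤ nuX ξ) :
    a ≤ nuX (η + ξ) := by
  rw [le_nuX_iff] at *
  intro q hq
  rcases HahnSeries.support_add_subset _ _ hq with hq | hq
  · exact h q hq
  · exact h' q hq

theorem nuX_neg (η : GenSeries) : nuX (-η) = nuX η := by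
  apply nuX_congr
  ext q
  simp

theorem nuX_sub_comm (η ξ : GenSeries) : nuX (η - ξ) = nuX (ξ - η) := by
  rw [← nuX_neg, neg_sub]

/-- The ultrametric inequality. -/
theorem le_nuX_sub_trans {η ξ ζ : GenSeries} {a : ℝ≥0∞} (h : a ≤ nuX (η - ξ))
    (h' : a ≤ nuX (ξ - ζ)) : a ≤ nuX (η - ζ) := by
  have := le_nuX_add h h'
  rwa [sub_add_sub_cancel] at this

theorem HasDenom.nonneg {N : ℕ} {η : GenSeries} (h : HasDenom N η) {q : ℚ}
    (hq : q ∈ η.support) : 0 ≤ q := by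
  obtain ⟨k, rfl⟩ := h q hq
  positivity

theorem IsNewtonPuiseux.nonneg {η : GenSeries} (h : IsNewtonPuiseux η) {q : ℚ}
    (hq : q ∈ η.support) : 0 ≤ q := by
  obtain ⟨N, -, hN⟩ := h
  exact HasDenom.nonneg hN hq

theorem IsNewtonPuiseux.order_nonneg {η : GenSeries} (h : IsNewtonPuiseux η) : 0 ≤ η.order := by
  by_cases h0 : η = 0
  · simp [h0]
  · exact h.nonneg (order_mem_support h0)

theorem IsNewtonPuiseux.sub {η ξ : GenSeries} (h : IsNewtonPuiseux η) (h' : IsNewtonPuiseux ξ) :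
    IsNewtonPuiseux (η - ξ) := by
  obtain ⟨N, hN, h1, h2⟩ := h.common h'
  exact (h1.sub hN h2).isNewtonPuiseux hN

theorem IsNewtonPuiseux.add {η ξ : GenSeries} (h : IsNewtonPuiseux η) (h' : IsNewtonPuiseux ξ) :
    IsNewtonPuiseux (η + ξ) := by
  obtain ⟨N, hN, h1, h2⟩ := h.common h'
  exact (h1.add hN h2).isNewtonPuiseux hN

theorem IsNewtonPuiseux.mul {η ξ : GenSeries} (h : IsNewtonPuiseux η) (h' : IsNewtonPuiseux ξ) :
    IsNewtonPuiseux (η * ξ) := by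
  obtain ⟨N, hN, h1, h2⟩ := h.common h'
  exact (h1.mul hN h2).isNewtonPuiseux hN

theorem nuX_mul {η ξ : GenSeries} (h : IsNewtonPuiseux η) (h' : IsNewtonPuiseux ξ) :
    nuX (η * ξ) = nuX η + nuX ξ := by
  by_cases h0 : η = 0
  · simp [h0, nuX_zero]
  by_cases h1 : ξ = 0
  · simp [h1, nuX_zero]
  rw [nuX_of_ne_zero h0, nuX_of_ne_zero h1, nuX_of_ne_zero (mul_ne_zero h0 h1),
    HahnSeries.order_mul h0 h1, ratVal, ratVal, ratVal, ← ENNReal.ofReal_add]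
  · push_cast; rfl
  · exact_mod_cast h.order_nonneg
  · exact_mod_cast h'.order_nonneg

theorem IsNewtonPuiseux.one : IsNewtonPuiseux 1 :=
  (map_one (rootEmb 1 one_ne_zero) ▸ hasDenom_rootEmb one_ne_zero 1).isNewtonPuiseux one_ne_zero

theorem nuX_one : nuX 1 = 0 := by
  rw [nuX_of_ne_zero one_ne_zero, HahnSeries.order_one]
  simp [ratVal]

theorem isNewtonPuiseux_prod {ι : Type*} (s : Finset ι) (g : ι → GenSeries)
    (h : ∀ i ∈ s, IsNewtonPuiseux (g i)) : IsNewtonPuiseux (∏ i ∈ s, g i) := by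
  classical
  induction s using Finset.induction_on with
  | empty => simpa using IsNewtonPuiseux.one
  | insert i s hi ih =>
    rw [Finset.prod_insert hi]
    exact (h i (by simp)).mul (ih fun j hj => h j (by simp [hj]))

theorem nuX_prod {ι : Type*} (s : Finset ι) (g : ι → GenSeries)
    (h : ∀ i ∈ s, IsNewtonPuiseux (g i)) : nuX (∏ i ∈ s, g i) = ∑ i ∈ s, nuX (g i) := by
  classical
  induction s using Finset.induction_on with
  | empty => simpa using nuX_one
  | insert i s hi ih =>
    rw [Finset.prod_insert hi, Finset.sum_insert hi, nuX_mul (h i (by simp)), ih]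
    · exact fun j hj => h j (by simp [hj])
    · exact isNewtonPuiseux_prod s g fun j hj => h j (by simp [hj])

theorem IsPosNP.evalAt_isNewtonPuiseux {η : GenSeries} (h : IsPosNP η) (f : FormalRing) :
    IsNewtonPuiseux (evalAt f η) := by
  obtain ⟨N, hN, ψ, hψ, rfl⟩ := h.exists_rootEmb
  rw [evalAt_rootEmb hN hψ]
  exact (hasDenom_rootEmb hN _).isNewtonPuiseux hN

theorem IsPosNP.nuX_evalAt_unit {η : GenSeries} (h : IsPosNP η) {u : FormalRing}
    (hu : IsUnit u) : nuX (evalAt u η) = 0 := by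
  obtain ⟨v, rfl⟩ := hu
  have h1 : nuX (evalAt (v : FormalRing) η) + nuX (evalAt ((v⁻¹ : FormalRingˣ) : FormalRing) η)
      = 0 := by
    rw [← nuX_mul (h.evalAt_isNewtonPuiseux _) (h.evalAt_isNewtonPuiseux _), ← evalHom_apply h,
      ← evalHom_apply h, ← map_mul, Units.mul_inv, map_one, nuX_one]
  exact (add_eq_zero.1 h1).1

theorem IsPosNP.evalAt_unit_ne_zero {η : GenSeries} (h : IsPosNP η) {u : FormalRing}
    (hu : IsUnit u) : evalAt u η ≠ 0 := by
  intro h0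
  have := h.nuX_evalAt_unit hu
  rw [h0, nuX_zero] at this
  exact ENNReal.top_ne_zero this

theorem IsPosNP.evalAt_mul {η : GenSeries} (h : IsPosNP η) (f g : FormalRing) :
    evalAt (f * g) η = evalAt f η * evalAt g η := by
  simp only [← evalHom_apply h, map_mul]

/-! ### The monodromy -/

/-- The character `q ↦ exp (2 π i m q)` of `ℚ`. -/
def phase (m : ℤ) (q : ℚ) : ℂ := Complex.exp (2 * Real.pi * Complex.I * (m * q : ℚ))

theorem phase_add_right (m : ℤ) (p q : ℚ) : phase m (p + q) = phase m p * phase m q := by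
  rw [phase, phase, phase, ← Complex.exp_add]
  congr 1
  push_cast
  ring

theorem phase_add_left (m n : ℤ) (q : ℚ) : phase (m + n) q = phase m q * phase n q := by
  rw [phase, phase, phase, ← Complex.exp_add]
  congr 1
  push_cast
  ring

theorem phase_zero_left (q : ℚ) : phase 0 q = 1 := by simp [phase]

theorem phase_zero_right (m : ℤ) : phase m 0 = 1 := by simp [phase]

theorem phase_ne_zero (m : ℤ) (q : ℚ) : phase m q ≠ 0 := Complex.exp_ne_zero _

theorem phase_eq_one_iff (m : ℤ) (q : ℚ) : phase m q = 1 ↔ ∃ n : ℤ, (m : ℚ) * q = n := by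
  rw [phase, Complex.exp_eq_one_iff]
  have h2 : (2 * Real.pi * Complex.I : ℂ) ≠ 0 := Complex.two_pi_I_ne_zero
  refine exists_congr fun n => ?_
  rw [mul_comm (n : ℂ), mul_right_inj' h2]
  exact_mod_cast Iff.rfl

/-- The underlying function of the monodromy. -/
def turnFun (m : ℤ) (η : GenSeries) : GenSeries where
  coeff q := phase m q * η.coeff q
  isPWO_support' := η.isPWO_support.mono fun q hq => by
    rw [Function.mem_support] at hq
    exact right_ne_zero_of_mul hq

theorem support_turnFun (m : ℤ) (η : GenSeries) : (turnFun m η).support = η.support := by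
  ext q
  simp [HahnSeries.mem_support, turnFun, phase_ne_zero]

/-- The `m`-th power of the monodromy: the automorphism `x ^ q ↦ exp (2 π i m q) x ^ q` of the
ring of series with rational exponents. -/
def turn (m : ℤ) : GenSeries →+* GenSeries where
  toFun := turnFun m
  map_one' := by
    ext q
    simp only [turnFun, HahnSeries.coeff_one]
    split_ifs with h
    · rw [h, phase_zero_right, one_mul]
    · rw [mul_zero]
  map_zero' := by ext q; simp [turnFun]
  map_add' a b := by ext q; simp [turnFun, mul_add]
  map_mul' a b := by
    ext q
    have h1 : (turnFun m a * turnFun m b).coeff q = ∑ ij ∈ Finset.antidiagonal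
        a.isPWO_support b.isPWO_support q, (turnFun m a).coeff ij.1 * (turnFun m b).coeff ij.2 := by
      rw [HahnSeries.coeff_mul]
      congr! 1
      ext p
      simp [support_turnFun, Finset.mem_antidiagonal]
    rw [h1]
    simp only [turnFun, HahnSeries.coeff_mul, Finset.mul_sum]
    refine Finset.sum_congr rfl fun p hp => ?_
    rw [Finset.mem_antidiagonal] at hp
    rw [← hp.2.2, phase_add_right]
    ring

theorem coeff_turn (m : ℤ) (η : GenSeries) (q : ℚ) :
    (turn m η).coeff q = phase m q * η.coeff q := rfl

theorem support_turn (m : ℤ) (η : GenSeries) : (turn m η).support = η.support :=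
  support_turnFun m η

theorem turn_zero_left (η : GenSeries) : turn 0 η = η := by
  ext q
  rw [coeff_turn, phase_zero_left, one_mul]

theorem turn_turn (m n : ℤ) (η : GenSeries) : turn m (turn n η) = turn (m + n) η := by
  ext q
  rw [coeff_turn, coeff_turn, coeff_turn, phase_add_left, mul_assoc]

theorem turn_neg_turn (m : ℤ) (η : GenSeries) : turn (-m) (turn m η) = η := by
  rw [turn_turn, neg_add_cancel, turn_zero_left]

theorem nuX_turn (m : ℤ) (η : GenSeries) : nuX (turn m η) = nuX η :=
  nuX_congr (support_turn m η)

theorem hasDenom_turn {N : ℕ} {m : ℤ} {η : GenSeries} (h : HasDenom N η) :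
    HasDenom N (turn m η) := by
  intro q hq
  rw [support_turn] at hq
  exact h q hq

theorem orderTop_pos_iff {η : GenSeries} : 0 < η.orderTop ↔ ∀ q ∈ η.support, 0 < q := by
  by_cases h0 : η = 0
  · simp [h0]
  constructor
  · intro h q hq
    have := lt_of_lt_of_le h (HahnSeries.orderTop_le_of_coeff_ne_zero hq)
    exact_mod_cast this
  · intro h
    rw [← HahnSeries.order_eq_orderTop_of_ne_zero h0]
    exact_mod_cast h _ (order_mem_support h0)

theorem IsPosNP.isPosNP_turn {η : GenSeries} (h : IsPosNP η) (m : ℤ) : IsPosNP (turn m η) := by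
  obtain ⟨⟨N, hN, hd⟩, ho⟩ := h
  refine ⟨⟨N, hN, hasDenom_turn hd⟩, ?_⟩
  rw [orderTop_pos_iff] at ho ⊢
  rwa [support_turn]

theorem turn_of_dvd {N : ℕ} (hN : N ≠ 0) {η : GenSeries} (h : HasDenom N η) {m : ℤ}
    (hm : (N : ℤ) ∣ m) : turn m η = η := by
  ext q
  rw [coeff_turn]
  by_cases hq : η.coeff q = 0
  · rw [hq, mul_zero]
  obtain ⟨k, rfl⟩ := h q hq
  obtain ⟨c, rfl⟩ := hm
  rw [(phase_eq_one_iff _ _).2 ⟨c * k, ?_⟩, one_mul]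
  have : (N : ℚ) ≠ 0 := by exact_mod_cast hN
  push_cast
  field_simp

theorem turn_emod {N : ℕ} (hN : N ≠ 0) {η : GenSeries} (h : HasDenom N η) (m : ℤ) :
    turn (m % N) η = turn m η := by
  conv_rhs => rw [← Int.emod_add_mul_ediv m N, ← turn_turn, turn_of_dvd hN h (dvd_mul_right _ _)]

/-- A series with exponents in `(1 / N) ℕ` that is fixed by the monodromy has integral
exponents. -/
theorem hasDenom_one_of_turn_eq {N : ℕ} {η : GenSeries} (h : HasDenom N η)
    (h1 : turn 1 η = η) : HasDenom 1 η := by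
  intro q hq
  have h2 := congrArg (fun a => HahnSeries.coeff a q) h1
  simp only [coeff_turn] at h2
  have h3 : phase 1 q = 1 := mul_right_cancel₀ hq (by rw [h2, one_mul])
  obtain ⟨n, hn⟩ := (phase_eq_one_iff _ _).1 h3
  have h4 : (0 : ℚ) ≤ n := by
    rw [← hn]
    have := h.nonneg hq
    simpa using this
  obtain ⟨k, rfl⟩ := Int.eq_ofNat_of_zero_le (show (0 : ℤ) ≤ n by exact_mod_cast h4)
  exact ⟨k, by simpa using hn⟩

theorem turn_algebraMap (m : ℤ) (a : PowerSeries ℂ) :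
    turn m (algebraMap (PowerSeries ℂ) GenSeries a) = algebraMap (PowerSeries ℂ) GenSeries a := by
  rw [algebraMap_eq_rootEmb]
  refine turn_of_dvd one_ne_zero (hasDenom_rootEmb one_ne_zero a) ?_
  simp

theorem evalAt_turn {η : GenSeries} (h : IsPosNP η) (m : ℤ) (f : FormalRing) :
    evalAt f (turn m η) = turn m (evalAt f η) := by
  have hx : turn m (HahnSeries.single (1 : ℚ) (1 : ℂ)) = HahnSeries.single 1 1 := by
    rw [← rootEmb_X_pow one_ne_zero, ← algebraMap_eq_rootEmb, turn_algebraMap]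
  ext q
  rw [coeff_turn, coeff_evalAt f (h.isPosNP_turn m).2, coeff_evalAt f h.2]
  rw [← smul_eq_mul, smul_finsum]
  refine finsum_congr fun p => ?_
  conv_lhs => rw [← hx, ← map_pow (turn m), ← map_pow (turn m), ← map_mul (turn m), coeff_turn]
  rw [smul_eq_mul]
  ring

/-! ### Minimal polynomials and branches -/

open Classical in
/-- The conjugates of a series with exponents in `(1 / N) ℕ`. -/
def conj (N : ℕ) (η : GenSeries) : Finset GenSeries :=
  (Finset.range N).image fun m : ℕ => turn m η

open Classical in
theorem mem_conj_iff {N : ℕ} (hN : N ≠ 0) {η : GenSeries} (h : HasDenom N η) {s : GenSeries} :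
    s ∈ conj N η ↔ ∃ m : ℤ, turn m η = s := by
  rw [conj, Finset.mem_image]
  constructor
  · rintro ⟨m, -, hm⟩
    exact ⟨m, hm⟩
  · rintro ⟨m, rfl⟩
    have hN' : (0 : ℤ) < N := by exact_mod_cast Nat.pos_of_ne_zero hN
    obtain ⟨k, hk⟩ := Int.eq_ofNat_of_zero_le (Int.emod_nonneg m hN'.ne')
    refine ⟨k, ?_, ?_⟩
    · rw [Finset.mem_range]
      have := Int.emod_lt_of_pos m hN'
      omega
    · rw [← turn_emod hN h m, hk]

theorem self_mem_conj {N : ℕ} (hN : N ≠ 0) {η : GenSeries} (h : HasDenom N η) : η ∈ conj N η :=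
  (mem_conj_iff hN h).2 ⟨0, turn_zero_left η⟩

open Classical in
theorem image_turn_conj {N : ℕ} (hN : N ≠ 0) {η : GenSeries} (h : HasDenom N η) (m : ℤ) :
    (conj N η).image (turn m) = conj N η := by
  ext s
  rw [Finset.mem_image, mem_conj_iff hN h]
  constructor
  · rintro ⟨t, ht, rfl⟩
    obtain ⟨k, rfl⟩ := (mem_conj_iff hN h).1 ht
    exact ⟨m + k, (turn_turn m k η).symm⟩
  · rintro ⟨k, rfl⟩
    refine ⟨turn (k - m) η, (mem_conj_iff hN h).2 ⟨_, rfl⟩, ?_⟩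
    rw [turn_turn, add_sub_cancel]

theorem turn_injective (m : ℤ) : Function.Injective (turn m) :=
  Function.LeftInverse.injective (turn_neg_turn m)

/-- The product of `y - s` over all conjugates `s`. -/
def conjPoly (N : ℕ) (η : GenSeries) : Polynomial GenSeries :=
  ∏ s ∈ conj N η, (Polynomial.X - Polynomial.C s)

theorem conjPoly_monic (N : ℕ) (η : GenSeries) : (conjPoly N η).Monic :=
  Polynomial.monic_prod_of_monic _ _ fun s _ => Polynomial.monic_X_sub_C s

theorem natDegree_conjPoly (N : ℕ) (η : GenSeries) :
    (conjPoly N η).natDegree = (conj N η).card := by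
  rw [conjPoly, Polynomial.natDegree_prod_of_monic _ _ fun s _ => Polynomial.monic_X_sub_C s]
  simp

theorem map_turn_conjPoly {N : ℕ} (hN : N ≠ 0) {η : GenSeries} (h : HasDenom N η) (m : ℤ) :
    (conjPoly N η).map (turn m) = conjPoly N η := by
  classical
  conv_rhs => rw [conjPoly, ← image_turn_conj hN h m]
  rw [Finset.prod_image fun a _ b _ hab => turn_injective m hab, conjPoly, Polynomial.map_prod]
  simp

open Classical in
theorem hasDenom_of_mem_conj {N : ℕ} {η : GenSeries} (h : HasDenom N η) {s : GenSeries}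
    (hs : s ∈ conj N η) : HasDenom N s := by
  rw [conj, Finset.mem_image] at hs
  obtain ⟨m, -, rfl⟩ := hs
  exact hasDenom_turn h

/-- The polynomial `∏ (y - s)` descends to `ℂ⟦x ^ (1 / N)⟧`, with reduction a power of `y`. -/
theorem exists_map_rootEmb_eq_conjPoly {N : ℕ} (hN : N ≠ 0) {η : GenSeries} (h : HasDenom N η)
    (ho : 0 < η.orderTop) : ∃ p : Polynomial (PowerSeries ℂ), p.map (rootEmb N hN) = conjPoly N η ∧
      p.map PowerSeries.constantCoeff = Polynomial.X ^ (conj N η).card := by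
  have h1 : ∀ s : GenSeries, ∃ ψ, s ∈ conj N η →
      rootEmb N hN ψ = s ∧ PowerSeries.constantCoeff ψ = 0 := by
    intro s
    by_cases hs : s ∈ conj N η
    · obtain ⟨ψ, hψ⟩ := (hasDenom_of_mem_conj h hs).exists_eq_rootEmb hN
      refine ⟨ψ, fun _ => ⟨hψ, ?_⟩⟩
      rw [← orderTop_pos_rootEmb_iff hN, hψ]
      obtain ⟨m, rfl⟩ := (mem_conj_iff hN h).1 hs
      exact (IsPosNP.isPosNP_turn ⟨h.isNewtonPuiseux hN, ho⟩ m).2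
    · exact ⟨0, fun h => absurd h hs⟩
  choose ψ hψ using h1
  refine ⟨∏ s ∈ conj N η, (Polynomial.X - Polynomial.C (ψ s)), ?_, ?_⟩
  · rw [Polynomial.map_prod, conjPoly]
    refine Finset.prod_congr rfl fun s hs => ?_
    simp [(hψ s hs).1]
  · rw [Polynomial.map_prod, Finset.prod_congr rfl (g := fun _ => Polynomial.X), Finset.prod_const]
    intro s hs
    simp [(hψ s hs).2]

theorem algebraMap_genSeries_injective :
    Function.Injective (algebraMap (PowerSeries ℂ) GenSeries) := by
  intro a b h
  rw [algebraMap_eq_rootEmb, algebraMap_eq_rootEmb] at h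
  exact rootEmb_injective one_ne_zero h

instance isTorsionFree_genSeries : Module.IsTorsionFree (PowerSeries ℂ) GenSeries := by
  refine ⟨fun r hr a b hab => ?_⟩
  simp only [Algebra.smul_def] at hab
  exact mul_left_cancel₀ ((map_ne_zero_iff _ algebraMap_genSeries_injective).2 hr.ne_zero) hab

/-- The product of `y - s` over the conjugates is invariant under the monodromy, so it descends to
`ℂ⟦x⟧`. -/
theorem exists_map_algebraMap_eq_conjPoly {N : ℕ} (hN : N ≠ 0) {η : GenSeries}
    (h : HasDenom N η) (ho : 0 < η.orderTop) :
    ∃ q : Polynomial (PowerSeries ℂ), q.map (algebraMap (PowerSeries ℂ) GenSeries) = conjPoly N η ∧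
      q.natDegree = (conj N η).card ∧ Distinguished q := by
  obtain ⟨p, hp, hp0⟩ := exists_map_rootEmb_eq_conjPoly hN h ho
  have hlift : conjPoly N η ∈ Polynomial.lifts (algebraMap (PowerSeries ℂ) GenSeries) := by
    rw [Polynomial.lifts_iff_coeff_lifts]
    intro n
    have h1 : HasDenom N ((conjPoly N η).coeff n) := by
      rw [← hp, Polynomial.coeff_map]
      exact hasDenom_rootEmb hN _
    have h2 : turn 1 ((conjPoly N η).coeff n) = (conjPoly N η).coeff n := by
      conv_rhs => rw [← map_turn_conjPoly hN h 1, Polynomial.coeff_map]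
    obtain ⟨a, ha⟩ := (hasDenom_one_of_turn_eq h1 h2).exists_eq_rootEmb one_ne_zero
    exact ⟨a, by rw [algebraMap_eq_rootEmb, ha]⟩
  obtain ⟨q, hq, hqd, hqm⟩ :=
    Polynomial.lifts_and_natDegree_eq_and_monic hlift (conjPoly_monic N η)
  rw [natDegree_conjPoly] at hqd
  refine ⟨q, hq, hqd, ⟨⟨fun {n} hn => ?_⟩, hqm⟩⟩
  rw [mem_maximalIdeal_iff_constantCoeff]
  have h3 : rootEmb 1 one_ne_zero (q.coeff n) = rootEmb N hN (p.coeff n) := by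
    rw [← algebraMap_eq_rootEmb, ← Polynomial.coeff_map, hq, ← hp, Polynomial.coeff_map]
  rw [← orderTop_pos_rootEmb_iff one_ne_zero, h3, orderTop_pos_rootEmb_iff,
    ← Polynomial.coeff_map, hp0, Polynomial.coeff_X_pow, if_neg (by omega)]

/-- The minimal polynomial over `ℂ⟦x⟧`. -/
abbrev minPoly (η : GenSeries) : Polynomial (PowerSeries ℂ) := minpoly (PowerSeries ℂ) η

/-- The minimal polynomial is the product of `y - s` over the conjugates: the monodromy fixes
`ℂ⟦x⟧`, so each conjugate is a root of it. -/
theorem IsPosNP.minPoly_spec {η : GenSeries} (hη : IsPosNP η) {N : ℕ} (hN : N ≠ 0)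
    (h : HasDenom N η) : IsIntegral (PowerSeries ℂ) η ∧
      (minPoly η).map (algebraMap (PowerSeries ℂ) GenSeries) = conjPoly N η ∧
      (minPoly η).natDegree = (conj N η).card ∧ Distinguished (minPoly η) := by
  obtain ⟨q, hq, hqd, hqD⟩ := exists_map_algebraMap_eq_conjPoly hN h hη.2
  have hroot : Polynomial.aeval η q = 0 := by
    rw [← Polynomial.eval_map_algebraMap, hq, conjPoly, Polynomial.eval_prod]
    exact Finset.prod_eq_zero (self_mem_conj hN h) (by simp)
  have hint : IsIntegral (PowerSeries ℂ) η := ⟨q, hqD.monic, by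
    rwa [Polynomial.aeval_def] at hroot⟩
  have hdvd : minPoly η ∣ q := minpoly.isIntegrallyClosed_dvd hint hroot
  have hdvd' : conjPoly N η ∣ (minPoly η).map (algebraMap (PowerSeries ℂ) GenSeries) := by
    rw [conjPoly]
    refine Finset.prod_dvd_of_coprime (R := Polynomial GenSeries) (I := GenSeries)
      (s := fun s => Polynomial.X - Polynomial.C s) (fun a _ b _ hab => ?_) fun s hs => ?_
    · exact Polynomial.pairwise_coprime_X_sub_C (K := GenSeries)
        (s := (id : GenSeries → GenSeries)) Function.injective_id hab
    · rw [Polynomial.dvd_iff_isRoot, Polynomial.IsRoot]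
      obtain ⟨m, rfl⟩ := (mem_conj_iff hN h).1 hs
      have h1 := congrArg (turn m) (minpoly.aeval (PowerSeries ℂ) η)
      rw [← Polynomial.eval_map_algebraMap, map_zero] at h1
      rw [← h1, ← Polynomial.eval_map_apply, Polynomial.map_map]
      congr 2
      ext1 a
      rw [RingHom.comp_apply, turn_algebraMap]
  have hmon : (minPoly η).Monic := minpoly.monic hint
  have hdeg : (minPoly η).natDegree = q.natDegree := by
    refine le_antisymm (Polynomial.natDegree_le_of_dvd hdvd hqD.monic.ne_zero) ?_
    rw [hqd, ← natDegree_conjPoly, ← hmon.natDegree_map (algebraMap (PowerSeries ℂ) GenSeries)]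
    exact Polynomial.natDegree_le_of_dvd hdvd' (hmon.map _).ne_zero
  have heq : q = minPoly η :=
    Polynomial.eq_of_monic_of_dvd_of_natDegree_le hmon hqD.monic hdvd hdeg.ge
  rw [heq] at hq hqd hqD
  exact ⟨hint, hq, hqd, hqD⟩

theorem IsPosNP.isIntegral {η : GenSeries} (hη : IsPosNP η) : IsIntegral (PowerSeries ℂ) η := by
  obtain ⟨N, hN, h⟩ := hη.1
  exact (hη.minPoly_spec hN h).1

theorem IsPosNP.distinguished_minPoly {η : GenSeries} (hη : IsPosNP η) :
    Distinguished (minPoly η) := by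
  obtain ⟨N, hN, h⟩ := hη.1
  exact (hη.minPoly_spec hN h).2.2.2

instance isDomain_formalRing : IsDomain FormalRing :=
  iterEquiv.symm.injective.isDomain iterEquiv.symm.toRingHom

/-- The series vanishing at `η` are the multiples of the equation of `C_η`. -/
theorem IsPosNP.evalAt_eq_zero_iff {η : GenSeries} (hη : IsPosNP η) (f : FormalRing) :
    evalAt f η = 0 ↔ polyToSeries (minPoly η) ∣ f := by
  constructor
  · intro h
    obtain ⟨q, r, hr, hf⟩ := hη.distinguished_minPoly.exists_series_division f
    have h1 : Polynomial.aeval η r = 0 := by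
      rw [hf, ← evalHom_apply hη, map_add, map_mul, evalHom_apply, evalHom_apply, evalHom_apply,
        evalAt_polyToSeries hη, evalAt_polyToSeries hη, minpoly.aeval, zero_mul, zero_add] at h
      exact h
    have h2 : r = 0 := by
      refine Polynomial.eq_zero_of_dvd_of_degree_lt
        (minpoly.isIntegrallyClosed_dvd hη.isIntegral h1) ?_
      rwa [Polynomial.degree_eq_natDegree (minpoly.monic hη.isIntegral).ne_zero]
    rw [hf, h2]
    simp [polyToSeries_eq]
  · rintro ⟨g, rfl⟩
    rw [hη.evalAt_mul, evalAt_polyToSeries hη, minpoly.aeval, zero_mul]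

theorem IsPosNP.prime_minPoly {η : GenSeries} (hη : IsPosNP η) :
    Prime (polyToSeries (minPoly η)) := by
  have h0 : evalAt (polyToSeries (minPoly η)) η = 0 :=
    (hη.evalAt_eq_zero_iff _).2 dvd_rfl
  refine ⟨?_, fun hu => hη.evalAt_unit_ne_zero hu h0, fun a b hab => ?_⟩
  · intro h
    apply hη.distinguished_minPoly.not_xCoord_dvd
    rw [h]
    exact dvd_zero _
  · rw [← hη.evalAt_eq_zero_iff, hη.evalAt_mul, mul_eq_zero, hη.evalAt_eq_zero_iff,
      hη.evalAt_eq_zero_iff] at hab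
    exact hab

theorem prime_xCoord : Prime xCoord := by
  refine ⟨?_, ?_, fun a b h => ?_⟩
  · rw [← iterEquiv_C_X, Ne, map_eq_zero_iff _ iterEquiv.injective]
    intro h
    exact PowerSeries.X_ne_zero (PowerSeries.C_injective (h.trans (map_zero _).symm))
  · intro h
    have := h.map restrictL
    rw [(restrictL_eq_zero_iff xCoord).2 dvd_rfl] at this
    exact not_isUnit_zero this
  · rw [← restrictL_eq_zero_iff, map_mul, mul_eq_zero, restrictL_eq_zero_iff,
      restrictL_eq_zero_iff] at h
    exact h

theorem Z_eq_Z_iff {f g : FormalRing} : Z f = Z g ↔ Associated f g :=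
  Associates.mk_eq_mk_iff_associated

theorem Z_eq_L_iff {f : FormalRing} (hf : Irreducible f) : Z f = L ↔ xCoord ∣ f := by
  rw [L, Z_eq_Z_iff]
  exact ⟨fun h => h.symm.dvd, fun h => (prime_xCoord.irreducible.associated_of_dvd hf h).symm⟩

theorem irreducible_L : Irreducible L := Associates.irreducible_mk.2 prime_xCoord.irreducible

theorem IsPosNP.irreducible_branchOf {η : GenSeries} (hη : IsPosNP η) :
    Irreducible (branchOf η) :=
  Associates.irreducible_mk.2 hη.prime_minPoly.irreducible

theorem IsPosNP.branchOf_ne_L {η : GenSeries} (hη : IsPosNP η) : branchOf η ≠ L := by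
  rw [branchOf, Ne, Z_eq_L_iff hη.prime_minPoly.irreducible]
  exact hη.distinguished_minPoly.not_xCoord_dvd

theorem IsPosNP.Z_eq_branchOf_iff {η : GenSeries} (hη : IsPosNP η) {f : FormalRing}
    (hf : Irreducible f) : Z f = branchOf η ↔ evalAt f η = 0 := by
  rw [hη.evalAt_eq_zero_iff, branchOf, Z_eq_Z_iff]
  exact ⟨fun h => h.symm.dvd,
    fun h => (hη.prime_minPoly.irreducible.associated_of_dvd hf h).symm⟩

theorem IsPosNP.branchOf_eq_branchOf_iff {η ξ : GenSeries} (hη : IsPosNP η) (hξ : IsPosNP ξ) :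
    branchOf η = branchOf ξ ↔ ∃ m : ℤ, turn m ξ = η := by
  obtain ⟨N, hN, h⟩ := hξ.1
  rw [eq_comm, branchOf, hη.Z_eq_branchOf_iff hξ.prime_minPoly.irreducible,
    evalAt_polyToSeries hη, ← Polynomial.eval_map_algebraMap, (hξ.minPoly_spec hN h).2.1,
    ← mem_conj_iff hN h, conjPoly, Polynomial.eval_prod, Finset.prod_eq_zero_iff]
  constructor
  · rintro ⟨s, hs, h0⟩
    rw [Polynomial.eval_sub, Polynomial.eval_X, Polynomial.eval_C, sub_eq_zero] at h0
    rwa [h0]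
  · exact fun hs => ⟨η, hs, by simp⟩

theorem IsPosNP.branchOf_turn {η : GenSeries} (hη : IsPosNP η) (m : ℤ) :
    branchOf (turn m η) = branchOf η :=
  ((hη.isPosNP_turn m).branchOf_eq_branchOf_iff hη).2 ⟨m, rfl⟩

/-- The roots of a branch are the series defining it. -/
theorem mem_roots_iff {A : Divisor} (hA : Irreducible A) {η : GenSeries} :
    η ∈ roots A ↔ IsPosNP η ∧ branchOf η = A := by
  obtain ⟨f, rfl⟩ := Associates.mk_surjective A
  have hf : Irreducible f := Associates.irreducible_mk.1 hA
  constructor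
  · rintro ⟨h1, h2, h3⟩
    have h : IsPosNP η := ⟨h1, h2⟩
    exact ⟨h, ((h.Z_eq_branchOf_iff hf).2 (h3 f rfl)).symm⟩
  · rintro ⟨h1, h2⟩
    refine ⟨h1.1, h1.2, fun g hg => ?_⟩
    rw [← h1.Z_eq_branchOf_iff, h2]
    · exact hg
    · exact Associates.irreducible_mk.1 (hg ▸ hA : Irreducible (Z g))

theorem roots_branchOf {ξ : GenSeries} (hξ : IsPosNP ξ) :
    roots (branchOf ξ) = {η | ∃ m : ℤ, turn m ξ = η} := by
  ext η
  rw [mem_roots_iff hξ.irreducible_branchOf, Set.mem_ofPred_eq]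
  constructor
  · rintro ⟨h1, h2⟩
    exact (h1.branchOf_eq_branchOf_iff hξ).1 h2
  · rintro ⟨m, rfl⟩
    exact ⟨hξ.isPosNP_turn m, hξ.branchOf_turn m⟩

theorem roots_L : roots L = ∅ := by
  rw [Set.eq_empty_iff_forall_notMem]
  intro η h
  rw [mem_roots_iff irreducible_L] at h
  exact h.1.branchOf_ne_L h.2

/-- The Newton-Puiseux theorem: every branch other than `L` is of the form `C_ξ`. -/
theorem exists_branchOf_eq {A : Divisor} (hA : Irreducible A) (hL : A ≠ L) :
    ∃ ξ, IsPosNP ξ ∧ branchOf ξ = A := by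
  obtain ⟨f, rfl⟩ := Associates.mk_surjective A
  have hf : Irreducible f := Associates.irreducible_mk.1 hA
  change Z f ≠ L at hL
  rw [Ne, Z_eq_L_iff hf] at hL
  obtain ⟨w, u, hw, hu, hfe⟩ := exists_weierstrass hL
  have hpos : 0 < w.natDegree := by
    rw [Nat.pos_iff_ne_zero]
    intro h0
    rw [Polynomial.Monic.natDegree_eq_zero hw.monic] at h0
    rw [hfe, h0, polyToSeries_one, one_mul] at hf
    exact hf.not_isUnit hu
  obtain ⟨N, hN, ψ, hψ, hroot⟩ := hw.exists_root hpos
  have hη : IsPosNP (rootEmb N hN ψ) :=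
    ⟨(hasDenom_rootEmb hN ψ).isNewtonPuiseux hN, (orderTop_pos_rootEmb_iff hN ψ).2 hψ⟩
  refine ⟨_, hη, ?_⟩
  rw [eq_comm]
  change Z f = _
  rw [hη.Z_eq_branchOf_iff hf, hfe, hη.evalAt_mul, evalAt_polyToSeries hη,
    ← Polynomial.eval_map_algebraMap]
  have h1 : algebraMap (PowerSeries ℂ) GenSeries = (rootEmb N hN).comp (ramify N hN) := by
    ext1 a
    rw [RingHom.comp_apply, rootEmb_ramify]
  rw [h1, ← Polynomial.map_map, Polynomial.eval_map_apply, hroot, map_zero, zero_mul]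

/-- The intersection number of `C_η` with `L` is the number of conjugates of `η`. -/
theorem IsPosNP.intersectionNumber_eq {η : GenSeries} (hη : IsPosNP η) {N : ℕ} (hN : N ≠ 0)
    (h : HasDenom N η) {f : FormalRing} (hf : Z f = branchOf η) :
    intersectionNumber xCoord f = (conj N η).card := by
  rw [branchOf, Z_eq_Z_iff] at hf
  obtain ⟨u, hu⟩ := hf.symm
  rw [← hu, hη.distinguished_minPoly.intersectionNumber_eq u.isUnit,
    (hη.minPoly_spec hN h).2.2.1]

/-- The order of `f(x, η)` is the sum of the contacts of `η` with the roots of `f`. -/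
theorem IsPosNP.nuX_evalAt_eq_sum {η ζ : GenSeries} (hη : IsPosNP η) (hζ : IsPosNP ζ) {N : ℕ}
    (hN : N ≠ 0) (h : HasDenom N η) {f : FormalRing} (hf : Z f = branchOf η) :
    nuX (evalAt f ζ) = ∑ s ∈ conj N η, nuX (ζ - s) := by
  rw [branchOf, Z_eq_Z_iff] at hf
  obtain ⟨u, hu⟩ := hf.symm
  have h1 : evalAt (polyToSeries (minPoly η)) ζ = ∏ s ∈ conj N η, (ζ - s) := by
    rw [evalAt_polyToSeries hζ, ← Polynomial.eval_map_algebraMap, (hη.minPoly_spec hN h).2.1,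
      conjPoly, Polynomial.eval_prod]
    simp
  rw [← hu, hζ.evalAt_mul, nuX_mul (hζ.evalAt_isNewtonPuiseux _) (hζ.evalAt_isNewtonPuiseux _),
    hζ.nuX_evalAt_unit u.isUnit, add_zero, h1, nuX_prod]
  exact fun s hs => hζ.1.sub ((hasDenom_of_mem_conj h hs).isNewtonPuiseux hN)

/-! ### Contacts between conjugates -/

/-- The contact of `ξ` with its conjugate under the `m`-th power of the monodromy. -/
abbrev selfContact (ξ : GenSeries) (m : ℤ) : ℝ≥0∞ := nuX (ξ - turn m ξ)

theorem order_congr {η ξ : GenSeries} (h : η.support = ξ.support) : η.order = ξ.order := by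
  by_cases h0 : η = 0
  · subst h0
    have : ξ = 0 := by
      rw [← HahnSeries.support_eq_empty_iff, ← h, HahnSeries.support_zero]
    rw [this]
  · have h1 : ξ ≠ 0 := by
      rintro rfl
      rw [HahnSeries.support_zero, HahnSeries.support_eq_empty_iff] at h
      exact h0 h
    exact le_antisymm (HahnSeries.order_le_of_coeff_ne_zero
      (HahnSeries.mem_support _ _ |>.1 (h ▸ order_mem_support h1)))
      (HahnSeries.order_le_of_coeff_ne_zero
      (HahnSeries.mem_support _ _ |>.1 (h.symm ▸ order_mem_support h0)))

theorem mem_charExps_iff {ξ : GenSeries} (hξ : IsPosNP ξ) {q : ℚ} :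
    q ∈ charExps (branchOf ξ) ↔ ∃ m : ℤ, ξ ≠ turn m ξ ∧ q = (ξ - turn m ξ).order := by
  rw [charExps, Set.mem_ofPred_eq, roots_branchOf hξ]
  constructor
  · rintro ⟨_, ⟨a, rfl⟩, _, ⟨b, rfl⟩, hne, rfl⟩
    have h1 : turn a ξ - turn b ξ = turn a (ξ - turn (b - a) ξ) := by
      rw [map_sub, turn_turn, add_sub_cancel]
    refine ⟨b - a, fun h => hne ?_, ?_⟩
    · rw [← sub_eq_zero, h1, sub_eq_zero.2 h, map_zero]
    · rw [h1]
      exact order_congr (support_turn _ _)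
  · rintro ⟨m, hne, rfl⟩
    exact ⟨ξ, ⟨0, turn_zero_left ξ⟩, turn m ξ, ⟨m, rfl⟩, hne, rfl⟩

theorem mem_support_sub_turn {ξ : GenSeries} {m : ℤ} {q : ℚ} :
    q ∈ (ξ - turn m ξ).support ↔ q ∈ ξ.support ∧ phase m q ≠ 1 := by
  rw [HahnSeries.mem_support, HahnSeries.mem_support, HahnSeries.coeff_sub, coeff_turn,
    ← one_sub_mul, mul_ne_zero_iff, sub_ne_zero, and_comm, ne_comm (a := (1 : ℂ))]

/-- The contact of `ξ` with a conjugate is governed by the characteristic exponents. -/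
theorem le_selfContact_iff {ξ : GenSeries} (hξ : IsPosNP ξ) {m : ℤ} {a : ℝ≥0∞} :
    a ≤ selfContact ξ m ↔ ∀ q ∈ charExps (branchOf ξ), ratVal q < a → phase m q = 1 := by
  constructor
  · intro h q hq hqa
    by_contra hne
    obtain ⟨k, hk, rfl⟩ := (mem_charExps_iff hξ).1 hq
    have h1 := order_mem_support (sub_ne_zero.2 hk)
    have h2 := mem_support_sub_turn.2 ⟨(mem_support_sub_turn.1 h1).1, hne⟩
    exact absurd (le_nuX_iff.1 h _ h2) (not_le.2 hqa)
  · intro h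
    by_cases h0 : ξ = turn m ξ
    · rw [selfContact, sub_eq_zero.2 h0, nuX_zero]
      exact le_top
    · by_contra hcon
      rw [selfContact, nuX_of_ne_zero (sub_ne_zero.2 h0), not_le] at hcon
      have h1 := h _ ((mem_charExps_iff hξ).2 ⟨m, h0, rfl⟩) hcon
      exact (mem_support_sub_turn.1 (order_mem_support (sub_ne_zero.2 h0))).2 h1

theorem charExps_spec {ξ : GenSeries} (hξ : IsPosNP ξ) {N : ℕ} (h : HasDenom N ξ)
    {q : ℚ} (hq : q ∈ charExps (branchOf ξ)) : 0 < q ∧ ∃ k : ℕ, q = (k : ℚ) / N := by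
  obtain ⟨m, hm, rfl⟩ := (mem_charExps_iff hξ).1 hq
  have h1 := (mem_support_sub_turn.1 (order_mem_support (sub_ne_zero.2 hm))).1
  exact ⟨orderTop_pos_iff.1 hξ.2 _ h1, h _ h1⟩

open Classical in
theorem finite_charExps {ξ : GenSeries} (hξ : IsPosNP ξ) : (charExps (branchOf ξ)).Finite := by
  obtain ⟨N, hN, h⟩ := hξ.1
  refine Set.Finite.subset ((Finset.range N).image fun m : ℕ => (ξ - turn m ξ).order).finite_toSet ?_
  intro q hq
  obtain ⟨m, hm, rfl⟩ := (mem_charExps_iff hξ).1 hq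
  have h1 := (mem_conj_iff hN h).2 ⟨m, rfl⟩
  rw [conj, Finset.mem_image] at h1
  obtain ⟨k, hk, hk'⟩ := h1
  rw [Finset.mem_coe, Finset.mem_image]
  exact ⟨k, hk, by rw [hk']⟩

/-! ### The index -/

/-- A group between `ℤ` and `(1 / N) ℤ` is generated by some `1 / d` with `d ∣ N`. -/
theorem exists_eq_zmultiples_inv {N : ℕ} (hN : N ≠ 0) {S : AddSubgroup ℚ} (h1 : (1 : ℚ) ∈ S)
    (hS : ∀ q ∈ S, ∃ k : ℤ, q = (k : ℚ) / N) :
    ∃ d : ℕ, d ≠ 0 ∧ d ∣ N ∧ S = AddSubgroup.zmultiples ((d : ℚ)⁻¹) := by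
  have hN' : (N : ℚ) ≠ 0 := by exact_mod_cast hN
  let φ : ℤ →+ ℚ :=
    { toFun := fun k => (k : ℚ) / N
      map_zero' := by simp
      map_add' := fun a b => by push_cast; ring }
  obtain ⟨g', hg⟩ := Int.subgroup_cyclic (S.comap φ)
  obtain ⟨g, hgg⟩ : ∃ g : ℕ, g = g'.natAbs := ⟨_, rfl⟩
  have hmem : ∀ k : ℤ, (k : ℚ) / N ∈ S ↔ (g : ℤ) ∣ k := by
    intro k
    rw [hgg, Int.natAbs_dvd, ← Int.mem_zmultiples_iff, AddSubgroup.zmultiples_eq_closure, ← hg]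
    rfl
  obtain ⟨d, rfl⟩ : g ∣ N := by
    rw [← Int.natCast_dvd_natCast, ← hmem]
    simpa [hN'] using h1
  have hgq : (g : ℚ) ≠ 0 := by exact_mod_cast left_ne_zero_of_mul hN
  have hdq : (d : ℚ) ≠ 0 := by exact_mod_cast right_ne_zero_of_mul hN
  refine ⟨d, right_ne_zero_of_mul hN, dvd_mul_left _ _, ?_⟩
  ext q
  rw [AddSubgroup.mem_zmultiples_iff]
  constructor
  · intro hq
    obtain ⟨k, rfl⟩ := hS q hq
    obtain ⟨c, rfl⟩ := (hmem k).1 hq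
    refine ⟨c, ?_⟩
    rw [zsmul_eq_mul]
    push_cast
    field_simp
  · rintro ⟨c, rfl⟩
    have : c • (d : ℚ)⁻¹ = ((g * c : ℤ) : ℚ) / (g * d : ℕ) := by
      rw [zsmul_eq_mul]
      push_cast
      field_simp
    rw [this, hmem]
    exact dvd_mul_right _ _

theorem relIndex_zmultiples_inv {d : ℕ} (hd : d ≠ 0) :
    (AddSubgroup.zmultiples (1 : ℚ)).relIndex (AddSubgroup.zmultiples ((d : ℚ)⁻¹)) = d := by
  have hd' : (d : ℚ) ≠ 0 := by exact_mod_cast hd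
  let φ : ℤ →+ ℚ := zmultiplesHom ℚ ((d : ℚ)⁻¹)
  have hφ : ∀ k : ℤ, φ k = (k : ℚ) * (d : ℚ)⁻¹ := fun k => by simp [φ]
  have hinj : Function.Injective φ := by
    intro a b hab
    rw [hφ, hφ] at hab
    exact_mod_cast mul_right_cancel₀ (inv_ne_zero hd') hab
  have h1 : AddSubgroup.zmultiples (1 : ℚ) = (AddSubgroup.zmultiples (d : ℤ)).map φ := by
    rw [AddMonoidHom.map_zmultiples, hφ]
    simp [hd']
  have h2 : AddSubgroup.zmultiples ((d : ℚ)⁻¹) = (⊤ : AddSubgroup ℤ).map φ := by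
    ext q
    simp [AddSubgroup.mem_zmultiples_iff, hφ]
  rw [h1, h2, AddSubgroup.relIndex_map_map_of_injective _ _ hinj, AddSubgroup.relIndex_top_right,
    Int.index_zmultiples]
  simp

theorem card_filter_dvd_range {d N : ℕ} (hd : d ≠ 0) (h : d ∣ N) :
    ((Finset.range N).filter fun m => d ∣ m).card * d = N := by
  obtain ⟨c, rfl⟩ := h
  have : (Finset.range (d * c)).filter (fun m => d ∣ m) = (Finset.range c).image fun k => d * k := by
    ext m
    simp only [Finset.mem_filter, Finset.mem_range, Finset.mem_image]
    constructor
    · rintro ⟨h1, k, rfl⟩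
      exact ⟨k, lt_of_mul_lt_mul_left h1 (Nat.zero_le _), rfl⟩
    · rintro ⟨k, hk, rfl⟩
      exact ⟨Nat.mul_lt_mul_of_pos_left hk (Nat.pos_of_ne_zero hd), dvd_mul_right _ _⟩
  rw [this, Finset.card_image_of_injective _ fun a b h =>
      Nat.eq_of_mul_eq_mul_left (Nat.pos_of_ne_zero hd) h,
    Finset.card_range, mul_comm]

open Classical in
/-- The number of conjugates having contact at least `a` with `ξ`, counted over the powers of the
monodromy, is inversely proportional to the index at exponent `a`. -/
theorem card_selfContact_mul_index {ξ : GenSeries} (hξ : IsPosNP ξ) {N : ℕ} (hN : N ≠ 0)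
    (h : HasDenom N ξ) (a : ℝ≥0∞) :
    ((Finset.range N).filter fun m : ℕ => a ≤ selfContact ξ m).card * index (branchOf ξ) a
      = N := by
  set E : Set ℚ := {1} ∪ {q | q ∈ charExps (branchOf ξ) ∧ ratVal q < a} with hE
  have hN' : (N : ℚ) ≠ 0 := by exact_mod_cast hN
  obtain ⟨d, hd, hdN, hS⟩ := exists_eq_zmultiples_inv hN (S := AddSubgroup.closure E)
    (AddSubgroup.subset_closure (Or.inl rfl)) (fun q hq => by
      induction hq using AddSubgroup.closure_induction with
      | mem q hq =>
        rcases hq with rfl | hq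
        · exact ⟨N, by simp [hN']⟩
        · obtain ⟨-, k, hk⟩ := charExps_spec hξ h hq.1
          exact ⟨k, by exact_mod_cast hk⟩
      | zero => exact ⟨0, by simp⟩
      | add p q _ _ hp hq =>
        obtain ⟨k, rfl⟩ := hp
        obtain ⟨l, rfl⟩ := hq
        exact ⟨k + l, by push_cast; ring⟩
      | neg p _ hp =>
        obtain ⟨k, rfl⟩ := hp
        exact ⟨-k, by push_cast; ring⟩)
  have hindex : index (branchOf ξ) a = d := by
    rw [index, hS, relIndex_zmultiples_inv hd]
  have hdq : (d : ℚ) ≠ 0 := by exact_mod_cast hd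
  -- `exp (2 π i m q) = 1` on the characteristic exponents `< a` iff on the group `(1 / d) ℤ`
  -- generated by them and `1`
  have hiff : ∀ m : ℕ, a ≤ selfContact ξ m ↔ d ∣ m := by
    intro m
    rw [le_selfContact_iff hξ]
    have key : (∀ q ∈ AddSubgroup.closure E, phase m q = 1) ↔
        ∀ q ∈ charExps (branchOf ξ), ratVal q < a → phase m q = 1 := by
      constructor
      · exact fun H q hq hqa => H q (AddSubgroup.subset_closure (Or.inr ⟨hq, hqa⟩))
      · intro H q hq
        induction hq using AddSubgroup.closure_induction with
        | mem q hq =>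
          rcases hq with rfl | hq
          · exact (phase_eq_one_iff _ _).2 ⟨m, by simp⟩
          · exact H q hq.1 hq.2
        | zero => exact phase_zero_right _
        | add p q _ _ hp hq => rw [phase_add_right, hp, hq, one_mul]
        | neg p _ hp =>
          have := phase_add_right m p (-p)
          rwa [add_neg_cancel, phase_zero_right, hp, one_mul, eq_comm] at this
    rw [← key, hS]
    constructor
    · intro H
      obtain ⟨n, hn⟩ := (phase_eq_one_iff _ _).1 (H _ (AddSubgroup.mem_zmultiples _))
      have h1 : (m : ℤ) = n * d := by
        have h2 : (m : ℚ) = n * d := by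
          rw [← div_eq_iff hdq, div_eq_mul_inv]
          exact_mod_cast hn
        exact_mod_cast h2
      exact_mod_cast (Dvd.intro_left n h1.symm : (d : ℤ) ∣ m)
    · rintro ⟨c, rfl⟩ q hq
      obtain ⟨k, rfl⟩ := AddSubgroup.mem_zmultiples_iff.1 hq
      refine (phase_eq_one_iff _ _).2 ⟨c * k, ?_⟩
      rw [zsmul_eq_mul]
      push_cast
      field_simp
  simp only [hiff]
  rw [hindex, card_filter_dvd_range hd hdN]

/-! ### Contact complexities as mean contacts -/

theorem alpha_le_succ (A : Divisor) (j : ℕ) : alpha A j ≤ alpha A (j + 1) :=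
  le_sInf fun _ hb => hb.1.le

theorem alpha_succ_le {A : Divisor} {j : ℕ} {q : ℚ} (hq : q ∈ charExps A)
    (h : alpha A j < ratVal q) : alpha A (j + 1) ≤ ratVal q :=
  sInf_le ⟨h, q, hq, rfl⟩

theorem alpha_succ_mem {A : Divisor} (hfin : (charExps A).Finite) {j : ℕ}
    (h : alpha A (j + 1) ≠ ⊤) :
    alpha A j < alpha A (j + 1) ∧ ∃ q ∈ charExps A, alpha A (j + 1) = ratVal q := by
  set B : Set ℝ≥0∞ := {b | alpha A j < b ∧ ∃ q ∈ charExps A, b = ratVal q} with hB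
  have hBfin : B.Finite := (hfin.image ratVal).subset (by
    rintro b ⟨-, q, hq, rfl⟩
    exact ⟨q, hq, rfl⟩)
  have hne : B.Nonempty := by
    rw [Set.nonempty_iff_ne_empty]
    intro h0
    apply h
    change sInf B = ⊤
    rw [h0, sInf_empty]
  exact hne.csInf_mem hBfin

theorem exists_alpha_eq_top {A : Divisor} (hfin : (charExps A).Finite) :
    ∃ j, alpha A (j + 1) = ⊤ := by
  by_contra! h
  have hmono : StrictMono (alpha A) := strictMono_nat_of_lt_succ fun j =>
    (alpha_succ_mem hfin (h j)).1
  have hinf : (Set.range fun j => alpha A (j + 1)).Infinite :=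
    Set.infinite_range_of_injective fun a b hab => by
      have := hmono.injective hab
      omega
  refine hinf ((hfin.image ratVal).subset ?_)
  rintro _ ⟨j, rfl⟩
  obtain ⟨-, q, hq, e⟩ := alpha_succ_mem hfin (h j)
  exact ⟨q, hq, e.symm⟩

/-- A contact cannot lie strictly between consecutive characteristic exponents. -/
theorem selfContact_le_alpha {ξ : GenSeries} (hξ : IsPosNP ξ) {m : ℤ} {j : ℕ}
    (h : selfContact ξ m < alpha (branchOf ξ) (j + 1)) :
    selfContact ξ m ≤ alpha (branchOf ξ) j := by
  by_contra! hcon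
  have h0 : ξ ≠ turn m ξ := by
    intro h0
    rw [selfContact, sub_eq_zero.2 h0, nuX_zero] at h
    exact not_top_lt h
  have h1 := (mem_charExps_iff hξ).2 ⟨m, h0, rfl⟩
  rw [selfContact, nuX_of_ne_zero (sub_ne_zero.2 h0)] at h hcon
  exact absurd (alpha_succ_le h1 hcon) (not_le.2 h)

/-- The increment of the sum of truncated contacts along an interval of constant index. -/
theorem sum_min_selfContact_step {ξ : GenSeries} (hξ : IsPosNP ξ) {N : ℕ} (hN : N ≠ 0)
    (h : HasDenom N ξ) {l : ℕ} {a : ℝ≥0∞} (h1 : alpha (branchOf ξ) l ≤ a)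
    (h2 : a ≤ alpha (branchOf ξ) (l + 1)) :
    ∑ m ∈ Finset.range N, min a (selfContact ξ m) =
      ∑ m ∈ Finset.range N, min (alpha (branchOf ξ) l) (selfContact ξ m) +
      N * ((a - alpha (branchOf ξ) l) /
        (index (branchOf ξ) (alpha (branchOf ξ) (l + 1)) : ℝ≥0∞)) := by
  classical
  set A := branchOf ξ
  have hcard := card_selfContact_mul_index hξ hN h (alpha A (l + 1))
  set c := ((Finset.range N).filter fun m : ℕ => alpha A (l + 1) ≤ selfContact ξ m).card
  set i := index A (alpha A (l + 1))
  have hi : (i : ℝ≥0∞) ≠ 0 := by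
    intro hi
    rw [Nat.cast_eq_zero.1 hi, mul_zero] at hcard
    exact hN hcard.symm
  have hc : (N : ℝ≥0∞) * ((a - alpha A l) / i) = c * (a - alpha A l) := by
    rw [← hcard, Nat.cast_mul, mul_assoc, ENNReal.mul_div_cancel hi (ENNReal.natCast_ne_top i)]
  have hc' : (c : ℝ≥0∞) * (a - alpha A l) = ∑ m ∈ Finset.range N,
      if alpha A (l + 1) ≤ selfContact ξ m then a - alpha A l else 0 := by
    rw [← Finset.sum_filter, Finset.sum_const, nsmul_eq_mul]
  rw [hc, hc', ← Finset.sum_add_distrib]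
  refine Finset.sum_congr rfl fun m _ => ?_
  split_ifs with hm
  · rw [min_eq_left (h2.trans hm), min_eq_left ((h1.trans h2).trans hm), add_tsub_cancel_of_le h1]
  · have hm' := selfContact_le_alpha hξ (not_le.1 hm)
    rw [min_eq_right (hm'.trans h1), min_eq_right hm', add_zero]

theorem sum_min_selfContact_alpha {ξ : GenSeries} (hξ : IsPosNP ξ) {N : ℕ} (hN : N ≠ 0)
    (h : HasDenom N ξ) (l : ℕ) :
    ∑ m ∈ Finset.range N, min (alpha (branchOf ξ) l) (selfContact ξ m) =
      N * ∑ j ∈ Finset.range l, (alpha (branchOf ξ) (j + 1) - alpha (branchOf ξ) j) /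
        (index (branchOf ξ) (alpha (branchOf ξ) (j + 1)) : ℝ≥0∞) := by
  induction l with
  | zero => simp [alpha]
  | succ l ih =>
    rw [sum_min_selfContact_step hξ hN h (alpha_le_succ _ l) le_rfl, ih, Finset.sum_range_succ,
      mul_add]

/-- The contact complexity at exponent `a` is the mean of the contacts of `ξ` with its conjugates,
truncated at `a`. -/
theorem sum_min_selfContact {ξ : GenSeries} (hξ : IsPosNP ξ) {N : ℕ} (hN : N ≠ 0)
    (h : HasDenom N ξ) (a : ℝ≥0∞) :
    ∑ m ∈ Finset.range N, min a (selfContact ξ m) = N * contactOnBranch (branchOf ξ) a := by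
  set A := branchOf ξ
  obtain ⟨j, hj⟩ := exists_alpha_eq_top (finite_charExps hξ)
  have hne : {l : ℕ | a ≤ alpha A (l + 1)}.Nonempty := ⟨j, by
    change a ≤ alpha A (j + 1)
    rw [hj]
    exact le_top⟩
  rw [contactOnBranch]
  set l := sInf {l : ℕ | a ≤ alpha A (l + 1)} with hl
  have h2 : a ≤ alpha A (l + 1) := Nat.sInf_mem hne
  have h1 : alpha A l ≤ a := by
    rcases Nat.eq_zero_or_pos l with h0 | h0
    · rw [h0]
      exact zero_le
    · obtain ⟨k, hk⟩ : ∃ k, l = k + 1 := ⟨l - 1, by omega⟩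
      have : k ∉ {l : ℕ | a ≤ alpha A (l + 1)} := Nat.notMem_of_lt_sInf (by omega)
      rw [hk]
      exact (not_le.1 this).le
  rw [sum_min_selfContact_step hξ hN h h1 h2, sum_min_selfContact_alpha hξ hN h, ← mul_add]

/-- Sums over the powers of the monodromy are proportional to sums over the conjugates. -/
theorem sum_turn_mul_card {ξ : GenSeries} {N : ℕ} (hN : N ≠ 0) (h : HasDenom N ξ)
    (g : GenSeries → ℝ≥0∞) :
    (∑ m ∈ Finset.range N, g (turn m ξ)) * (conj N ξ).card = N * ∑ s ∈ conj N ξ, g s := by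
  classical
  let T : (GenSeries → ℕ) → ℕ := fun g => ∑ m ∈ Finset.range N, g (turn m ξ)
  have hshift : ∀ g, T (fun s => g (turn 1 s)) = T g := by
    intro g
    have h1 := Finset.sum_range_succ (fun m : ℕ => g (turn m ξ)) N
    rw [Finset.sum_range_succ', turn_of_dvd hN h dvd_rfl] at h1
    simp only [Nat.cast_zero, turn_zero_left] at h1
    have h2 := Nat.add_right_cancel h1
    simp only [T, turn_turn]
    rw [← h2]
    refine Finset.sum_congr rfl fun m _ => ?_
    rw [add_comm, Nat.cast_succ]
  -- `k s` counts the powers taking `ξ` to `s`; it is constant on the orbit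
  let k : GenSeries → ℕ := fun s => T fun t => if t = s then 1 else 0
  have hk : ∀ s, k (turn 1 s) = k s := by
    intro s
    have := hshift fun t => if t = turn 1 s then 1 else 0
    simp only [(turn_injective 1).eq_iff] at this
    exact this.symm
  have hk' : ∀ m : ℕ, k (turn m ξ) = k ξ := by
    intro m
    induction m with
    | zero => rw [Nat.cast_zero, turn_zero_left]
    | succ m ih => rw [← ih, ← hk (turn m ξ), turn_turn, Nat.cast_succ, add_comm]
  have hkc : ∀ s, ((Finset.range N).filter fun m : ℕ => turn m ξ = s).card = k s := by
    intro s
    rw [Finset.card_filter]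
  have hks : ∀ s ∈ conj N ξ, ((Finset.range N).filter fun m : ℕ => turn m ξ = s).card = k ξ := by
    intro s hs
    rw [conj, Finset.mem_image] at hs
    obtain ⟨m, -, rfl⟩ := hs
    rw [hkc, hk']
  have hsum : ∀ g : GenSeries → ℝ≥0∞, ∑ m ∈ Finset.range N, g (turn m ξ) =
      k ξ * ∑ s ∈ conj N ξ, g s := by
    intro g
    rw [Finset.sum_comp g (fun m : ℕ => turn m ξ), Finset.mul_sum]
    refine Finset.sum_congr (by rw [conj]) fun s hs => ?_
    have hs' : s ∈ conj N ξ := by rw [conj]; exact hs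
    rw [nsmul_eq_mul, ← hks s hs']
  have hN1 : (N : ℝ≥0∞) = k ξ * (conj N ξ).card := by
    have := hsum fun _ => 1
    simpa using this
  rw [hsum, hN1]
  ring

/-- The contact complexity as a mean over the roots of the branch. -/
theorem sum_conj_min {ξ : GenSeries} (hξ : IsPosNP ξ) {N : ℕ} (hN : N ≠ 0)
    (h : HasDenom N ξ) (a : ℝ≥0∞) :
    ∑ s ∈ conj N ξ, min a (nuX (ξ - s)) =
      (conj N ξ).card * contactOnBranch (branchOf ξ) a := by
  have h1 := sum_turn_mul_card hN h fun s => min a (nuX (ξ - s))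
  rw [sum_min_selfContact hξ hN h a] at h1
  have hN0 : (N : ℝ≥0∞) ≠ 0 := by exact_mod_cast hN
  rw [mul_assoc, ENNReal.mul_right_inj hN0 (ENNReal.natCast_ne_top N)] at h1
  rw [← h1, mul_comm]

/-! ### Orders of coincidence -/

theorem le_coincidence_iff {η ξ : GenSeries} (hη : IsPosNP η) (hξ : IsPosNP ξ) {a : ℝ≥0∞} :
    a ≤ coincidence (branchOf η) (branchOf ξ) ↔ ∃ m : ℤ, a ≤ nuX (η - turn m ξ) := by
  classical
  obtain ⟨N, hN, h⟩ := hξ.1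
  set K : Set ℝ≥0∞ := {k | ∃ x ∈ roots (branchOf η), ∃ y ∈ roots (branchOf ξ), k = nuX (x - y)}
    with hK
  have hKeq : K = {k | ∃ m : ℤ, k = nuX (η - turn m ξ)} := by
    rw [hK, roots_branchOf hη, roots_branchOf hξ]
    ext k
    constructor
    · rintro ⟨_, ⟨a, rfl⟩, _, ⟨b, rfl⟩, rfl⟩
      refine ⟨b - a, ?_⟩
      rw [← nuX_turn a (η - turn (b - a) ξ), map_sub, turn_turn, add_sub_cancel]
    · rintro ⟨m, rfl⟩
      exact ⟨η, ⟨0, turn_zero_left η⟩, _, ⟨m, rfl⟩, rfl⟩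
  change a ≤ sSup K ↔ _
  constructor
  · intro ha
    have hfin : K.Finite := by
      refine ((conj N ξ).image fun s => nuX (η - s)).finite_toSet.subset ?_
      rw [hKeq]
      rintro _ ⟨m, rfl⟩
      rw [Finset.mem_coe, Finset.mem_image]
      exact ⟨_, (mem_conj_iff hN h).2 ⟨m, rfl⟩, rfl⟩
    have hne : K.Nonempty := by
      rw [hKeq]
      exact ⟨_, 0, rfl⟩
    have hmem := hne.csSup_mem hfin
    rw [hKeq] at hmem
    obtain ⟨m, hm⟩ := hmem
    rw [hKeq, hm] at ha
    exact ⟨m, ha⟩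
  · rintro ⟨m, hm⟩
    refine hm.trans (le_sSup ?_)
    rw [hKeq]
    exact ⟨m, rfl⟩

/-- Branches with a high order of coincidence have the same contact complexities up to it. -/
theorem contactOnBranch_congr {η ξ : GenSeries} (hη : IsPosNP η) (hξ : IsPosNP ξ) {a : ℝ≥0∞}
    (h : a ≤ coincidence (branchOf η) (branchOf ξ)) :
    contactOnBranch (branchOf η) a = contactOnBranch (branchOf ξ) a := by
  obtain ⟨k, hk⟩ := (le_coincidence_iff hη hξ).1 h
  -- replace `ξ` by the conjugate closest to `η`
  have hξ' := hξ.isPosNP_turn k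
  rw [← hξ.branchOf_turn k]
  generalize turn k ξ = ζ at hk hξ'
  obtain ⟨N, hN, h1, h2⟩ := hη.1.common hξ'.1
  have hN0 : (N : ℝ≥0∞) ≠ 0 := by exact_mod_cast hN
  rw [← ENNReal.mul_right_inj hN0 (ENNReal.natCast_ne_top N), ← sum_min_selfContact hη hN h1,
    ← sum_min_selfContact hξ' hN h2]
  have key : ∀ {x y : GenSeries}, a ≤ nuX (x - y) → ∀ m : ℤ,
      min a (selfContact x m) ≤ min a (selfContact y m) := by
    intro x y hxy m
    refine le_min (min_le_left _ _) ?_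
    have h3 : min a (selfContact x m) ≤ nuX (y - x) :=
      (min_le_left _ _).trans (by rwa [nuX_sub_comm])
    have h4 : min a (selfContact x m) ≤ nuX (turn m x - turn m y) := by
      rw [← map_sub, nuX_turn]
      exact (min_le_left _ _).trans hxy
    exact le_nuX_sub_trans (le_nuX_sub_trans h3 (min_le_right _ _)) h4
  refine Finset.sum_congr rfl fun m _ => le_antisymm (key hk m) (key ?_ m)
  rwa [nuX_sub_comm]

/-! ### Gluing is an equivalence relation -/

theorem coincidence_comm (A B : Divisor) : coincidence A B = coincidence B A := by
  rw [coincidence, coincidence]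
  congr 1
  ext k
  constructor
  · rintro ⟨x, hx, y, hy, rfl⟩
    exact ⟨y, hy, x, hx, nuX_sub_comm _ _⟩
  · rintro ⟨x, hx, y, hy, rfl⟩
    exact ⟨y, hy, x, hx, nuX_sub_comm _ _⟩

theorem coincidence_L (A : Divisor) : coincidence L A = 0 := by
  simp [coincidence, roots_L]

/-- The ultrametric property of the order of coincidence. -/
theorem le_coincidence_trans {A B D : Divisor} (hA : Irreducible A) (hB : Irreducible B)
    (hD : Irreducible D) {a : ℝ≥0∞} (h : a ≤ coincidence A B) (h' : a ≤ coincidence B D) :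
    a ≤ coincidence A D := by
  by_cases hAL : A = L
  · rw [hAL, coincidence_L] at h
    exact h.trans zero_le
  by_cases hBL : B = L
  · rw [hBL, coincidence_L] at h'
    exact h'.trans zero_le
  by_cases hDL : D = L
  · rw [hDL, coincidence_comm, coincidence_L] at h'
    exact h'.trans zero_le
  obtain ⟨η, hη, rfl⟩ := exists_branchOf_eq hA hAL
  obtain ⟨ξ, hξ, rfl⟩ := exists_branchOf_eq hB hBL
  obtain ⟨ζ, hζ, rfl⟩ := exists_branchOf_eq hD hDL
  rw [le_coincidence_iff hη hξ] at h
  rw [le_coincidence_iff hξ hζ] at h'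
  rw [le_coincidence_iff hη hζ]
  obtain ⟨m, hm⟩ := h
  obtain ⟨n, hn⟩ := h'
  refine ⟨m + n, le_nuX_sub_trans hm ?_⟩
  rwa [← turn_turn, ← map_sub, nuX_turn]

/-- The segments of `A` and `B` coincide up to exponent `a`. -/
def Near (a : ℝ≥0∞) (A B : Divisor) : Prop := A = B ∨ a ≤ coincidence A B

theorem Near.symm {a : ℝ≥0∞} {A B : Divisor} (h : Near a A B) : Near a B A := by
  rcases h with h | h
  · exact Or.inl h.symm
  · exact Or.inr (coincidence_comm A B ▸ h)

theorem Near.trans {a : ℝ≥0∞} {A B D : Divisor} (hA : Irreducible A) (hB : Irreducible B)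
    (hD : Irreducible D) (h : Near a A B) (h' : Near a B D) : Near a A D := by
  rcases h with rfl | h
  · exact h'
  rcases h' with rfl | h'
  · exact Or.inr h
  exact Or.inr (le_coincidence_trans hA hB hD h h')

theorem Near.mono {a b : ℝ≥0∞} {A B : Divisor} (h : Near a A B) (hb : b ≤ a) : Near b A B :=
  h.imp_right hb.trans

theorem near_zero (A B : Divisor) : Near 0 A B := Or.inr zero_le

theorem near_iff {ξ η : GenSeries} (hξ : IsPosNP ξ) (hη : IsPosNP η) (d : ℝ≥0∞) :
    Near d (branchOf ξ) (branchOf η) ↔ d ≤ coincidence (branchOf ξ) (branchOf η) := by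
  refine ⟨fun h => ?_, Or.inr⟩
  rcases h with h | h
  · rw [le_coincidence_iff hξ hη]
    obtain ⟨m, hm⟩ := (hξ.branchOf_eq_branchOf_iff hη).1 h
    exact ⟨m, by rw [hm, sub_self, nuX_zero]; exact le_top⟩
  · exact h

/-- The exponent up to which two segments coincide. -/
theorem exists_near_iff (A B : Divisor) :
    ∃ k : ℝ≥0∞, ∀ d, Near d A B ↔ d ≤ k := by
  by_cases h : A = B
  · exact ⟨⊤, fun d => ⟨fun _ => le_top, fun _ => Or.inl h⟩⟩
  · exact ⟨coincidence A B, fun d => ⟨fun h' => h'.resolve_left h, Or.inr⟩⟩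

theorem contactOnBranch_zero (A : Divisor) : contactOnBranch A 0 = 0 := by
  simp [contactOnBranch]

theorem contactOnBranch_congr_of_near {a : ℝ≥0∞} {A B : Divisor} (hA : Irreducible A)
    (hB : Irreducible B) (h : Near a A B) : contactOnBranch A a = contactOnBranch B a := by
  rcases h with rfl | h
  · rfl
  by_cases h0 : a = 0
  · rw [h0, contactOnBranch_zero, contactOnBranch_zero]
  have hAL : A ≠ L := by
    rintro rfl
    rw [coincidence_L] at h
    exact h0 (le_antisymm h zero_le)
  have hBL : B ≠ L := by
    rintro rfl
    rw [coincidence_comm, coincidence_L] at h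
    exact h0 (le_antisymm h zero_le)
  obtain ⟨η, hη, rfl⟩ := exists_branchOf_eq hA hAL
  obtain ⟨ξ, hξ, rfl⟩ := exists_branchOf_eq hB hBL
  exact contactOnBranch_congr hη hξ h

theorem glue_iff {C : Set Divisor} {p q : PrePoint C} :
    glue p q ↔ p.exponent = q.exponent ∧ Near p.exponent p.branch.1 q.branch.1 := by
  rw [glue, Near, Subtype.ext_iff]

theorem glue_equivalence {C : Set Divisor} (hC : ∀ B ∈ C, Irreducible B) :
    Equivalence (glue (C := C)) where
  refl p := ⟨rfl, Or.inl rfl⟩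
  symm {p q} h := by
    rw [glue_iff] at *
    exact ⟨h.1.symm, h.1 ▸ h.2.symm⟩
  trans {p q r} h h' := by
    rw [glue_iff] at *
    exact ⟨h.1.trans h'.1, h.2.trans (hC _ p.branch.2) (hC _ q.branch.2) (hC _ r.branch.2)
      (h.1 ▸ h'.2)⟩

theorem quot_mk_eq_iff {C : Set Divisor} (hC : ∀ B ∈ C, Irreducible B) {p q : PrePoint C} :
    Quot.mk glue p = Quot.mk glue q ↔ glue p q := by
  rw [Quot.eq, (glue_equivalence hC).eqvGen_iff]

namespace EWTree

/-! ### The order of the Eggers-Wall tree -/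

variable {C D : Set Divisor}

/-- The exponent `a` occurs on the segment of `A`. -/
abbrev Admissible (A : Divisor) (a : ℝ≥0∞) : Prop := A = L → a = 0

theorem exponent_point_of_admissible {A : C} {a : ℝ≥0∞} (h : Admissible A.1 a) :
    exponent (point A a) = a := by
  rw [exponent_point]
  split_ifs with hA
  · exact (h hA).symm
  · rfl

theorem point_eq_mk {A : C} {a : ℝ≥0∞} (h : Admissible A.1 a) :
    point A a = Quot.mk _ ⟨A, a, h⟩ := by
  unfold point
  congr 2
  split_ifs with hA
  · exact (h hA).symm
  · rfl

/-- The segment of `L` is reduced to the root, so the exponent of a point on it is set to `0`. -/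
theorem exists_admissible_point_eq (A : C) (a : ℝ≥0∞) :
    ∃ b, b ≤ a ∧ Admissible A.1 b ∧ point A a = point A b := by
  classical
  by_cases hA : A.1 = L
  · refine ⟨0, zero_le, fun _ => rfl, ?_⟩
    unfold point
    simp only [hA, if_true]
    rfl
  · exact ⟨a, le_rfl, fun h => absurd h hA, rfl⟩

theorem exists_eq_point_admissible (P : EWTree C) :
    ∃ (A : C) (a : ℝ≥0∞), Admissible A.1 a ∧ P = point A a := by
  obtain ⟨A, a, rfl⟩ := exists_eq_point P
  obtain ⟨b, -, hb, e⟩ := exists_admissible_point_eq A a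
  exact ⟨A, b, hb, e⟩

theorem point_eq_point_iff (hC : ∀ B ∈ C, Irreducible B) {A B : C} {a b : ℝ≥0∞}
    (ha : Admissible A.1 a) (hb : Admissible B.1 b) :
    point A a = point B b ↔ a = b ∧ Near a A.1 B.1 := by
  rw [point_eq_mk ha, point_eq_mk hb]
  exact (quot_mk_eq_iff hC).trans glue_iff

theorem contact_point (hC : ∀ B ∈ C, Irreducible B) {A : C} {a : ℝ≥0∞}
    (ha : Admissible A.1 a) : contact (point A a) = contactOnBranch A.1 a := by
  have h := glue_iff.1 ((quot_mk_eq_iff hC).1 ((Quot.out_eq _).trans (point_eq_mk ha)))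
  exact (contactOnBranch_congr_of_near (hC _ (Quot.out (point A a)).branch.2) (hC _ A.2)
    h.2).trans (congrArg _ h.1)

theorem mem_rootSegment_point_iff (hC : ∀ B ∈ C, Irreducible B) {A B : C} {a b : ℝ≥0∞}
    (ha : Admissible A.1 a) (hb : Admissible B.1 b) :
    point B b ∈ rootSegment (point A a) ↔ b ≤ a ∧ Near b B.1 A.1 := by
  constructor
  · rintro ⟨A', a', b', h1, h2, h3⟩
    by_cases hA' : A'.1 = L
    · have hb0 : b = 0 := by
        have := congrArg exponent h2
        rwa [exponent_point_of_admissible hb, exponent_point, if_pos hA'] at this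
      rw [hb0]
      exact ⟨zero_le, near_zero _ _⟩
    · rw [point_eq_point_iff hC ha (fun h => absurd h hA')] at h1
      rw [point_eq_point_iff hC hb (fun h => absurd h hA')] at h2
      obtain ⟨rfl, h1⟩ := h1
      obtain ⟨rfl, h2⟩ := h2
      exact ⟨h3, h2.trans (hC _ B.2) (hC _ A'.2) (hC _ A.2) (h1.symm.mono h3)⟩
  · rintro ⟨h1, h2⟩
    refine ⟨A, a, b, rfl, ?_, h1⟩
    rw [point_eq_point_iff hC hb]
    · exact ⟨rfl, h2⟩
    · intro h
      rw [ha h] at h1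
      exact le_antisymm h1 zero_le

/-- The order of the tree in terms of exponents and orders of coincidence. -/
theorem point_le_point_iff (hC : ∀ B ∈ C, Irreducible B) {A B : C} {a b : ℝ≥0∞}
    (ha : Admissible A.1 a) (hb : Admissible B.1 b) :
    point B b ≤ point A a ↔ b ≤ a ∧ Near b B.1 A.1 := by
  constructor
  · intro h
    exact (mem_rootSegment_point_iff hC ha hb).1 (h (mem_rootSegment_self _))
  · rintro ⟨h1, h2⟩ Q hQ
    obtain ⟨D, d, hd, rfl⟩ := exists_eq_point_admissible Q
    rw [mem_rootSegment_point_iff hC hb hd] at hQ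
    rw [mem_rootSegment_point_iff hC ha hd]
    exact ⟨hQ.1.trans h1, hQ.2.trans (hC _ D.2) (hC _ B.2) (hC _ A.2) (h2.mono hQ.1)⟩

theorem root_le (hC : ∀ B ∈ C, Irreducible B) (A : C) (P : EWTree C) : root A ≤ P := by
  obtain ⟨B, b, hb, rfl⟩ := exists_eq_point_admissible P
  exact (point_le_point_iff hC hb fun _ => rfl).2 ⟨zero_le, near_zero _ _⟩

/-- Two points meet at the smallest of their exponents and the exponent up to which their branches
coincide. -/
theorem isGLB_point (hC : ∀ B ∈ C, Irreducible B) {A B : C} {a b k : ℝ≥0∞}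
    (ha : Admissible A.1 a) (hb : Admissible B.1 b) (hk : ∀ d, Near d A.1 B.1 ↔ d ≤ k) :
    IsGLB {point A a, point B b} (point A (min (min a b) k)) := by
  have hm : Admissible A.1 (min (min a b) k) := fun h => by rw [ha h]; simp
  have hmk : Near (min (min a b) k) A.1 B.1 := (hk _).2 (min_le_right _ _)
  constructor
  · rintro P (rfl | rfl)
    · exact (point_le_point_iff hC ha hm).2
        ⟨(min_le_left _ _).trans (min_le_left _ _), Or.inl rfl⟩
    · exact (point_le_point_iff hC hb hm).2 ⟨(min_le_left _ _).trans (min_le_right _ _), hmk⟩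
  · intro P hP
    obtain ⟨D, d, hd, rfl⟩ := exists_eq_point_admissible P
    have h1 := (point_le_point_iff hC ha hd).1 (hP (Or.inl rfl))
    have h2 := (point_le_point_iff hC hb hd).1 (hP (Or.inr rfl))
    refine (point_le_point_iff hC hm hd).2 ⟨le_min (le_min h1.1 h2.1) ?_, h1.2⟩
    exact (hk d).1 (h1.2.symm.trans (hC _ A.2) (hC _ D.2) (hC _ B.2) h2.2)

/-- The center of a tripod with one end at the root is the meet of the two other ends. -/
theorem isTripodCenter_root (hC : ∀ B ∈ C, Irreducible B) (A : C) {P Q M : EWTree C}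
    (hM : IsGLB {P, Q} M) : IsTripodCenter (root A) P Q M := by
  have hroot : ∀ R : EWTree C, IsGLB {root A, R} (root A) := fun R =>
    ⟨by rintro S (rfl | rfl) <;> exact root_le hC A _, fun S hS => hS (Or.inl rfl)⟩
  have hseg : ∀ R X : EWTree C, X ∈ segment (root A) R ↔ X ≤ R := by
    intro R X
    constructor
    · rintro ⟨-, -, -, h | h⟩
      · exact h.trans (root_le hC A R)
      · exact h
    · exact fun h => ⟨root A, hroot R, root_le hC A X, Or.inr h⟩
  have hMP : M ≤ P := hM.1 (Or.inl rfl)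
  have hMQ : M ≤ Q := hM.1 (Or.inr rfl)
  rw [IsTripodCenter]
  ext X
  rw [Set.mem_singleton_iff]
  constructor
  · rintro ⟨⟨h1, M', h2, h3, -⟩, h4⟩
    rw [hseg] at h1 h4
    rw [hM.unique h2] at *
    refine le_antisymm (h2.2 ?_) h3
    rintro S (rfl | rfl)
    · exact h1
    · exact h4
  · rintro rfl
    exact ⟨⟨(hseg _ _).2 hMP, X, hM, le_rfl, Or.inl hMP⟩, (hseg _ _).2 hMQ⟩

end EWTree

/-! ### The functions `ν^{ξ, α}` -/

theorem isPosNP_of_mem_npBall {ξ ζ : GenSeries} (hξ : IsPosNP ξ) {α : ℝ≥0∞} (hα : α ≠ 0)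
    (h : ζ ∈ npBall ξ α) : IsPosNP ζ := by
  refine ⟨h.1, orderTop_pos_iff.2 fun q hq => ?_⟩
  by_contra! hcon
  have hq0 : q = 0 := le_antisymm hcon (h.1.nonneg hq)
  subst hq0
  have h1 : (0 : ℚ) ∉ ξ.support := fun h0 => lt_irrefl _ (orderTop_pos_iff.1 hξ.2 0 h0)
  have h2 : (0 : ℚ) ∈ (ζ - ξ).support := by
    rw [HahnSeries.mem_support, HahnSeries.coeff_sub]
    rw [HahnSeries.mem_support, not_not] at h1
    rwa [h1, sub_zero]
  have h3 := le_nuX_iff.1 h.2 0 h2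
  rw [ratVal, Rat.cast_zero, ENNReal.ofReal_zero] at h3
  exact hα (le_antisymm h3 zero_le)

theorem self_mem_npBall {ξ : GenSeries} (hξ : IsPosNP ξ) (α : ℝ≥0∞) : ξ ∈ npBall ξ α :=
  ⟨hξ.1, by rw [sub_self, nuX_zero]; exact le_top⟩

theorem nu_zero (ξ : GenSeries) : nu ξ 0 = ordL := by
  ext f
  simp [nu]

theorem isNewtonPuiseux_single {q : ℚ} (hq : 0 ≤ q) (c : ℂ) :
    IsNewtonPuiseux (HahnSeries.single q c) := by
  refine ⟨q.den, q.den_nz, fun p hp => ⟨q.num.toNat, ?_⟩⟩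
  have h1 : p = q := HahnSeries.support_single_subset hp
  have h2 : ((q.num.toNat : ℤ) : ℚ) = q.num := by
    rw [Int.toNat_of_nonneg (Rat.num_nonneg.2 hq)]
  rw [h1, ← Int.cast_natCast, h2, Rat.num_div_den]

/-- A generic perturbation of `ξ` at exponent `q` has no excess contact with finitely many given
series. -/
theorem exists_generic_perturbation {ξ : GenSeries} (hξ : IsPosNP ξ) {q : ℚ} (hq : 0 ≤ q)
    (S : Finset GenSeries) : ∃ ζ, IsNewtonPuiseux ζ ∧ ratVal q ≤ nuX (ζ - ξ) ∧
      ∀ s ∈ S, nuX (ζ - s) ≤ min (ratVal q) (nuX (ξ - s)) := by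
  classical
  obtain ⟨c, hc⟩ := Infinite.exists_notMem_finset (S.image fun s => -(ξ - s).coeff q)
  have h1 : ratVal q ≤ nuX (ξ + HahnSeries.single q c - ξ) := by
    rw [add_sub_cancel_left, le_nuX_iff]
    intro p hp
    have : p = q := HahnSeries.support_single_subset hp
    rw [this]
  refine ⟨ξ + HahnSeries.single q c, hξ.1.add (isNewtonPuiseux_single hq c), h1, fun s hs => ?_⟩
  have h2 : nuX (ξ + HahnSeries.single q c - s) ≤ ratVal q := by
    refine le_nuX_iff.1 le_rfl q ?_
    rw [HahnSeries.mem_support]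
    intro h0
    apply hc
    rw [Finset.mem_image]
    refine ⟨s, hs, ?_⟩
    rw [HahnSeries.coeff_sub, HahnSeries.coeff_add, HahnSeries.coeff_single_same] at h0
    rw [HahnSeries.coeff_sub]
    linear_combination -h0
  exact le_min h2 (le_nuX_sub_trans ((h2.trans h1).trans_eq (nuX_sub_comm _ _)) le_rfl)

theorem min_le_min_add_sub (a b c : ℝ≥0∞) : min b c ≤ min a c + (b - a) := by
  rcases le_total a c with h | h
  · rw [min_eq_left h]
    exact (min_le_left _ _).trans le_add_tsub
  · rw [min_eq_right h]
    exact (min_le_right _ _).trans le_self_add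

/-- The value of `ν^{ξ, α}` on a branch, in terms of the contacts of `ξ` with its roots. -/
theorem nu_eq_sum {ξ η : GenSeries} (hξ : IsPosNP ξ) (hη : IsPosNP η) {N : ℕ} (hN : N ≠ 0)
    (h : HasDenom N η) {f : FormalRing} (hf : Z f = branchOf η) {α : ℝ≥0∞} (hα : α ≠ 0) :
    nu ξ α f = ∑ s ∈ conj N η, min α (nuX (ξ - s)) := by
  rw [nu, if_neg hα]
  apply le_antisymm
  · by_cases htop : α = ⊤
    · refine (iInf₂_le ξ (self_mem_npBall hξ α)).trans ?_
      rw [hη.nuX_evalAt_eq_sum hξ hN h hf, htop]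
      simp
    · refine ENNReal.le_of_forall_pos_le_add fun ε hε _ => ?_
      set n := (conj N η).card with hn
      have hn0 : (n : ℝ≥0∞) ≠ 0 := by
        rw [Nat.cast_ne_zero, hn]
        exact Finset.card_ne_zero_of_mem (self_mem_conj hN h)
      have hlt : α < α + ε / n := by
        refine ENNReal.lt_add_right htop ?_
        rw [Ne, ENNReal.div_eq_zero_iff]
        push Not
        exact ⟨by exact_mod_cast hε.ne', ENNReal.natCast_ne_top n⟩
      -- the infimum need not be attained at an irrational `α`
      obtain ⟨q, hq0, hq1, hq2⟩ := ENNReal.lt_iff_exists_rat_btwn.1 hlt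
      change α < ratVal q at hq1
      change ratVal q < _ at hq2
      obtain ⟨ζ, hζ, hζξ, hζs⟩ := exists_generic_perturbation hξ hq0 (conj N η)
      have hmem : ζ ∈ npBall ξ α := ⟨hζ, hq1.le.trans hζξ⟩
      refine (iInf₂_le ζ hmem).trans ?_
      rw [hη.nuX_evalAt_eq_sum (isPosNP_of_mem_npBall hξ hα hmem) hN h hf]
      calc ∑ s ∈ conj N η, nuX (ζ - s)
          ≤ ∑ s ∈ conj N η, (min α (nuX (ξ - s)) + ε / n) := by
            refine Finset.sum_le_sum fun s hs => (hζs s hs).trans ?_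
            refine (min_le_min_add_sub α _ _).trans (add_le_add_right ?_ _)
            exact tsub_le_iff_left.2 hq2.le
        _ = _ := by
            rw [Finset.sum_add_distrib, Finset.sum_const, nsmul_eq_mul,
              ENNReal.mul_div_cancel hn0 (ENNReal.natCast_ne_top n)]
  · refine le_iInf₂ fun ζ hζ => ?_
    rw [hη.nuX_evalAt_eq_sum (isPosNP_of_mem_npBall hξ hα hζ) hN h hf]
    exact Finset.sum_le_sum fun s _ =>
      le_nuX_sub_trans ((min_le_left _ _).trans hζ.2) (min_le_right _ _)

theorem ordL_eq_zero {f : FormalRing} (hf : Irreducible f) (hL : Z f ≠ L) : ordL f = 0 := by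
  rw [Ne, Z_eq_L_iff hf] at hL
  rw [ordL, emultiplicity_eq_zero.2 hL]
  simp

theorem ordL_eq_one {f : FormalRing} (hL : Z f = L) : ordL f = 1 := by
  rw [L, Z_eq_Z_iff] at hL
  rw [ordL, emultiplicity_eq_of_associated_right hL,
    (FiniteMultiplicity.of_prime_left prime_xCoord prime_xCoord.ne_zero).emultiplicity_self]
  simp

/-- The value of `ν^{ξ, α}` on a branch other than `L`. -/
theorem nu_eq_mul_contact {ξ η : GenSeries} (hξ : IsPosNP ξ) (hη : IsPosNP η) {f : FormalRing}
    (hf : Irreducible f) (hfη : Z f = branchOf η) (α : ℝ≥0∞) :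
    nu ξ α f = (intersectionNumber xCoord f : ℝ≥0∞) * contactOnBranch (branchOf ξ)
      (min α (coincidence (branchOf ξ) (branchOf η))) := by
  by_cases hα : α = 0
  · rw [hα, nu_zero, ordL_eq_zero hf (hfη ▸ hη.branchOf_ne_L), min_eq_left zero_le,
      contactOnBranch_zero, mul_zero]
  set k := coincidence (branchOf ξ) (branchOf η) with hk
  obtain ⟨m, hm⟩ := (le_coincidence_iff hξ hη).1 hk.le
  -- replace `η` by the root of `f` closest to `ξ`
  have hη' := hη.isPosNP_turn m
  rw [← hη.branchOf_turn m] at hk hfη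
  generalize turn m η = ζ at hk hm hη' hfη
  obtain ⟨N, hN, hd⟩ := hη'.1
  rw [contactOnBranch_congr hξ hη' ((min_le_right _ _).trans hk.le),
    hη'.intersectionNumber_eq hN hd hfη, ENat.toENNReal_coe, ← sum_conj_min hη' hN hd,
    nu_eq_sum hξ hη' hN hd hfη hα]
  refine Finset.sum_congr rfl fun s hs => ?_
  have h1 : nuX (ξ - s) ≤ k := by
    obtain ⟨j, rfl⟩ := (mem_conj_iff hN hd).1 hs
    rw [hk, le_coincidence_iff hξ hη']
    exact ⟨j, le_rfl⟩
  rw [min_assoc]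
  congr 1
  exact le_antisymm
    (le_min h1 (le_nuX_sub_trans ((h1.trans hm).trans_eq (nuX_sub_comm _ _)) le_rfl))
    (le_nuX_sub_trans ((min_le_left _ _).trans hm) (min_le_right _ _))

theorem nu_eq_one {ξ : GenSeries} (hξ : IsPosNP ξ) {f : FormalRing} (hL : Z f = L)
    (α : ℝ≥0∞) : nu ξ α f = 1 := by
  by_cases hα : α = 0
  · rw [hα, nu_zero, ordL_eq_one hL]
  have key : ∀ ζ ∈ npBall ξ α, nuX (evalAt f ζ) = 1 := by
    intro ζ hζ
    have hζ' := isPosNP_of_mem_npBall hξ hα hζ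
    rw [L, Z_eq_Z_iff] at hL
    obtain ⟨u, rfl⟩ := hL.symm
    rw [hζ'.evalAt_mul, nuX_mul (hζ'.evalAt_isNewtonPuiseux _) (hζ'.evalAt_isNewtonPuiseux _),
      hζ'.nuX_evalAt_unit u.isUnit, add_zero, ← iterEquiv_C_X, evalAt_iterEquiv_C hζ'.2,
      HahnSeries.algebraMap_apply', Algebra.algebraMap_self_apply, HahnSeries.ofPowerSeries_X,
      nuX_of_ne_zero (by simp), HahnSeries.order_single one_ne_zero]
    simp [ratVal]
  rw [nu, if_neg hα]
  refine le_antisymm ((iInf₂_le ξ (self_mem_npBall hξ α)).trans (key ξ (self_mem_npBall hξ α)).le) ?_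
  exact le_iInf₂ fun ζ hζ => (key ζ hζ).ge

theorem nu_turn_le {ξ : GenSeries} (hξ : IsPosNP ξ) (m : ℤ) (α : ℝ≥0∞) (f : FormalRing) :
    nu (turn m ξ) α f ≤ nu ξ α f := by
  by_cases hα : α = 0
  · rw [hα, nu_zero, nu_zero]
  rw [nu, nu, if_neg hα, if_neg hα]
  refine le_iInf₂ fun ζ hζ => ?_
  have hζ' := isPosNP_of_mem_npBall hξ hα hζ
  refine (iInf₂_le (turn m ζ) ⟨(hζ'.isPosNP_turn m).1, ?_⟩).trans ?_
  · rw [evalAt_turn hζ', nuX_turn]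
  · rw [← map_sub, nuX_turn]
    exact hζ.2

theorem nu_turn {ξ : GenSeries} (hξ : IsPosNP ξ) (m : ℤ) (α : ℝ≥0∞) :
    nu (turn m ξ) α = nu ξ α := by
  ext f
  refine le_antisymm (nu_turn_le hξ m α f) ?_
  have := nu_turn_le (hξ.isPosNP_turn m) (-m) α f
  rwa [turn_neg_turn] at this

theorem nu_congr_of_le {ξ η : GenSeries} {α : ℝ≥0∞} (h : α ≤ nuX (ξ - η)) : nu ξ α = nu η α := by
  have hball : npBall ξ α = npBall η α := by
    ext ζ
    refine and_congr_right fun _ => ⟨fun h1 => le_nuX_sub_trans h1 h, fun h1 => ?_⟩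
    exact le_nuX_sub_trans h1 (by rwa [nuX_sub_comm])
  ext f
  rw [nu, nu, hball]

/-- The function `ν^{ξ, α}` depends only on the point of exponent `α` of the segment of `C_ξ`. -/
theorem nu_congr {ξ η : GenSeries} (hξ : IsPosNP ξ) (hη : IsPosNP η) {α : ℝ≥0∞}
    (h : Near α (branchOf ξ) (branchOf η)) : nu ξ α = nu η α := by
  obtain ⟨m, hm⟩ := (le_coincidence_iff hξ hη).1 ((near_iff hξ hη α).1 h)
  rw [nu_congr_of_le hm, nu_turn hη]

/-! ### The map to functions -/

open EWTree

theorem irreducible_insert {C : Set Divisor} (hC : ∀ B ∈ C, Irreducible B) {f : FormalRing}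
    (hf : Irreducible f) : ∀ B ∈ insert (Z f) C, Irreducible B := by
  rintro B (rfl | hB)
  · exact Associates.irreducible_mk.2 hf
  · exact hC B hB

theorem IsEmbeddingMap.apply_point {C : Set Divisor} {V : EWTree C → FormalRing → ℝ≥0∞}
    (hV : IsEmbeddingMap C V) (hC : ∀ B ∈ C, Irreducible B) {ξ : GenSeries} (hξ : IsPosNP ξ)
    (h : branchOf ξ ∈ C) (a : ℝ≥0∞) : V (point ⟨branchOf ξ, h⟩ a) = nu ξ a := by
  have hadm : ∀ b, Admissible (branchOf ξ) b := fun b h => absurd h hξ.branchOf_ne_L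
  refine hV.2 ξ hξ.1 hξ.2 h a _ ?_ (exponent_point_of_admissible (hadm a))
  exact (point_le_point_iff hC (hadm ⊤) (hadm a)).2 ⟨le_top, Or.inl rfl⟩

theorem eq_of_isEmbeddingMap {C : Set Divisor} (hC : ∀ B ∈ C, Irreducible B)
    {V W : EWTree C → FormalRing → ℝ≥0∞} (hV : IsEmbeddingMap C V) (hW : IsEmbeddingMap C W) :
    V = W := by
  ext1 P
  obtain ⟨⟨A, hA⟩, a, ha, rfl⟩ := exists_eq_point_admissible P
  by_cases hAL : A = L
  · have h0 : exponent (point (⟨A, hA⟩ : C) a) = 0 := by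
      rw [exponent_point_of_admissible ha, ha hAL]
    rw [hV.1 _ h0, hW.1 _ h0]
  · obtain ⟨ξ, hξ, rfl⟩ := exists_branchOf_eq (hC A hA) hAL
    rw [hV.apply_point hC hξ, hW.apply_point hC hξ]

theorem exists_isEmbeddingMap {C : Set Divisor} (hC : ∀ B ∈ C, Irreducible B) :
    ∃ V : EWTree C → FormalRing → ℝ≥0∞, IsEmbeddingMap C V := by
  have hex : ∀ P : EWTree C, ∃ F : FormalRing → ℝ≥0∞, (P.exponent = 0 → F = ordL) ∧
      ∀ ξ : GenSeries, IsPosNP ξ → ∀ h : branchOf ξ ∈ C, ∀ α : ℝ≥0∞,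
        P = point ⟨branchOf ξ, h⟩ α → F = nu ξ α := by
    intro P
    obtain ⟨⟨A, hA⟩, a, ha, rfl⟩ := exists_eq_point_admissible P
    rw [exponent_point_of_admissible ha]
    by_cases h0 : a = 0
    · refine ⟨ordL, fun _ => rfl, fun η hη h α e => ?_⟩
      rw [point_eq_point_iff hC ha fun h => absurd h hη.branchOf_ne_L] at e
      rw [← e.1, h0, nu_zero]
    · obtain ⟨ξ, hξ, rfl⟩ := exists_branchOf_eq (hC A hA) fun h => h0 (ha h)
      refine ⟨nu ξ a, fun h => absurd h h0, fun η hη h α e => ?_⟩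
      rw [point_eq_point_iff hC ha fun h => absurd h hη.branchOf_ne_L] at e
      obtain ⟨rfl, e⟩ := e
      exact nu_congr hξ hη e
  choose V hV using hex
  refine ⟨V, fun P => (hV P).1, fun ξ h1 h2 h α P hP hα => ?_⟩
  have hξ : IsPosNP ξ := ⟨h1, h2⟩
  have hadm : ∀ b, Admissible (branchOf ξ) b := fun b h => absurd h hξ.branchOf_ne_L
  refine (hV P).2 ξ hξ h α ?_
  obtain ⟨B, b, hb, rfl⟩ := exists_eq_point_admissible P
  rw [exponent_point_of_admissible hb] at hα
  subst hα
  rw [leaf, point_le_point_iff hC (hadm ⊤) hb] at hP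
  exact (point_eq_point_iff hC hb (hadm b)).2 ⟨rfl, hP.2⟩

end EggersWall

end

theorem proposition7p3 :
    -- the values of the functions `ν^{ξ, α}` on irreducible series
    (∀ f : FormalRing, Irreducible f →
      ∀ ξ : GenSeries, IsNewtonPuiseux ξ → 0 < ξ.orderTop →
      ∀ α : ENNReal,
        (∃! P : EWTree {branchOf ξ}, P.exponent = α) ∧
        ∀ P : EWTree {branchOf ξ}, P.exponent = α →
          (Z f ≠ L →
            ∃ Q M : EWTree {branchOf ξ, Z f},
              EWTree.IsTripodCenter
                (EWTree.root ⟨Z f, by simp⟩)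
                (EWTree.leaf ⟨branchOf ξ, by simp⟩)
                (EWTree.leaf ⟨Z f, by simp⟩) Q ∧
              IsLeast {EWTree.incl (by simp) P, Q} M ∧
              nu ξ α f =
                (intersectionNumber xCoord f : ENNReal) * M.contact) ∧
          (Z f = L → nu ξ α f = 1)) ∧
    -- the map `V_L` on the tree of a reduced germ is well defined, and its values on branches
    (∀ C : Set Divisor, C.Finite → (∀ B ∈ C, Irreducible B) →
      (∃! V : EWTree C → FormalRing → ENNReal,
        IsEmbeddingMap C V) ∧
      ∀ V : EWTree C → FormalRing → ENNReal,
        IsEmbeddingMap C V →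
        ∀ (P : EWTree C) (f : FormalRing), Irreducible f →
          (Z f ≠ L →
            ∃ Q M : EWTree (insert (Z f) C),
              EWTree.IsTripodCenter
                (EWTree.root ⟨Z f, by simp⟩)
                (EWTree.incl (by simp) P)
                (EWTree.leaf ⟨Z f, by simp⟩) Q ∧
              IsLeast {EWTree.incl (by simp) P, Q} M ∧
              V P f =
                (intersectionNumber xCoord f : ENNReal) * M.contact) ∧
          (Z f = L → V P f = 1)) := by
  constructor
  · intro f hf ξ h1 h2 α
    have hξ : IsPosNP ξ := ⟨h1, h2⟩
    have hadm : ∀ b, EWTree.Admissible (branchOf ξ) b := fun b h => absurd h hξ.branchOf_ne_L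
    have hrep : ∀ P : EWTree {branchOf ξ}, P.exponent = α →
        P = EWTree.point ⟨branchOf ξ, Set.mem_singleton _⟩ α := by
      intro P hP
      obtain ⟨⟨A, hA⟩, a, ha, hPA⟩ := EWTree.exists_eq_point_admissible P
      obtain rfl := Set.mem_singleton_iff.1 hA
      rw [hPA, EWTree.exponent_point_of_admissible ha] at hP
      rw [hPA, hP]
    refine ⟨⟨EWTree.point ⟨branchOf ξ, Set.mem_singleton _⟩ α,
      EWTree.exponent_point_of_admissible (hadm α), hrep⟩,
      fun P hP => ⟨fun hL => ?_, fun hL => nu_eq_one hξ hL α⟩⟩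
    obtain rfl := hrep P hP
    obtain ⟨η, hη, hηf⟩ := exists_branchOf_eq (Associates.irreducible_mk.2 hf) hL
    have hC : ∀ B ∈ ({branchOf ξ, Z f} : Set Divisor), Irreducible B := by
      rintro B (rfl | rfl)
      · exact hξ.irreducible_branchOf
      · exact Associates.irreducible_mk.2 hf
    have hadm' : ∀ b, EWTree.Admissible (Z f) b := fun b h => absurd h hL
    have hk : ∀ d, Near d (branchOf ξ) (Z f) ↔ d ≤ coincidence (branchOf ξ) (branchOf η) := by
      intro d
      rw [← near_iff hξ hη, hηf]
      rfl
    have hglb := EWTree.isGLB_point hC (A := ⟨branchOf ξ, by simp⟩) (B := ⟨Z f, by simp⟩)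
      (hadm ⊤) (hadm' ⊤) hk
    rw [min_self, min_eq_right le_top] at hglb
    refine ⟨_, EWTree.point ⟨branchOf ξ, by simp⟩ (min α (coincidence (branchOf ξ) (branchOf η))),
      EWTree.isTripodCenter_root hC _ hglb, ⟨?_, ?_⟩, ?_⟩
    · rcases le_total α (coincidence (branchOf ξ) (branchOf η)) with h | h
      · left
        rw [min_eq_left h]
        rfl
      · right
        rw [min_eq_right h]
        rfl
    · rintro R (rfl | rfl)
      · exact (EWTree.point_le_point_iff hC (hadm _) (hadm _)).2 ⟨min_le_left _ _, Or.inl rfl⟩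
      · exact (EWTree.point_le_point_iff hC (hadm _) (hadm _)).2 ⟨min_le_right _ _, Or.inl rfl⟩
    · rw [EWTree.contact_point hC (hadm _), nu_eq_mul_contact hξ hη hf hηf.symm]
  · intro C _ hC
    obtain ⟨V₀, hV₀⟩ := exists_isEmbeddingMap hC
    refine ⟨⟨V₀, hV₀, fun W hW => eq_of_isEmbeddingMap hC hW hV₀⟩, fun V hV P f hf => ⟨?_, ?_⟩⟩
    · intro hL
      obtain ⟨⟨A, hA⟩, a, ha, rfl⟩ := EWTree.exists_eq_point_admissible P
      have hC' := irreducible_insert hC hf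
      have hadm' : ∀ b, EWTree.Admissible (Z f) b := fun b h => absurd h hL
      obtain ⟨k, hk⟩ := exists_near_iff A (Z f)
      have hglb := EWTree.isGLB_point hC' (A := ⟨A, Or.inr hA⟩) (B := ⟨Z f, by simp⟩)
        ha (hadm' ⊤) hk
      rw [min_eq_left le_top] at hglb
      refine ⟨_, EWTree.point ⟨A, Or.inr hA⟩ (min a k),
        EWTree.isTripodCenter_root hC' _ hglb, ⟨Or.inr rfl, ?_⟩, ?_⟩
      · rintro R (rfl | rfl)
        · exact hglb.1 (Or.inl rfl)
        · exact le_rfl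
      · rw [EWTree.contact_point hC' fun h => by rw [ha h]; simp]
        by_cases h0 : a = 0
        · rw [hV.1 _ ((EWTree.exponent_point_of_admissible ha).trans h0), ordL_eq_zero hf hL, h0,
            min_eq_left zero_le, contactOnBranch_zero, mul_zero]
        · obtain ⟨ξ, hξ, rfl⟩ := exists_branchOf_eq (hC A hA) fun h => h0 (ha h)
          obtain ⟨η, hη, hηf⟩ := exists_branchOf_eq (Associates.irreducible_mk.2 hf) hL
          have hk' : k = coincidence (branchOf ξ) (branchOf η) := eq_of_forall_le_iff fun d => by
            rw [← hk, ← near_iff hξ hη, hηf]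
            exact Iff.rfl
          rw [hV.apply_point hC hξ, nu_eq_mul_contact hξ hη hf hηf.symm, hk']
    · intro hL
      obtain ⟨⟨A, hA⟩, a, ha, rfl⟩ := EWTree.exists_eq_point_admissible P
      by_cases h0 : a = 0
      · rw [hV.1 _ ((EWTree.exponent_point_of_admissible ha).trans h0), ordL_eq_one hL]
      · obtain ⟨ξ, hξ, rfl⟩ := exists_branchOf_eq (hC A hA) fun h => h0 (ha h)
        rw [hV.apply_point hC hξ, nu_eq_one hξ hL]
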